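/- **Setting.** Let $S$ be a set of states. For a set $X$ write $\mathsf V_{=1,\omega}(X)$ for the finite linear combinations $\sum_i p_i\cdot x_i$ of point masses on $X$ with $p_i\in\mathbb R_{\ge 0}$ and total mass $1$. Programs of concurrent pGCL are given by $$P ::= \mathtt{skip}\mid a\mid P;P\mid P\parallel P\mid P+_pP\mid P+P\mid \mathtt{if}\ b\ \mathtt{then}\ P\ \mathtt{else}\ P\mid\mathtt{while}\ b\ P,$$ with $p\in[0,1]\cap\mathbb Q$, atomic programs $a$ interpreted by $[\![a]\!]:S\to\mathsf V_{=1,\omega}(S)$ and conditions $b$ by $[\![b]\!]:S\to\{\mathtt{tt},\mathtt{ff}\}$. A configuration is a pair $\langle P,s\rangle$; let $\mathrm{Conf}$ be the set of configurations. The small-step relation $\langle P,s\rangle\to\nu$, with $\nu=\sum_i p_i\cdot\langle P_i,s_i\rangle+\sum_j p_j\cdot s_j\in\mathsf V_{=1,\omega}(S+\mathrm{Conf})$, is generated by: - $\langle a,s\rangle\to[\![a]\!](s)$ and $\langle\mathtt{skip},s\rangle\to 1\cdot s$; - if $\langle P,s\rangle\to\sum_ip_i\cdot\langle P_i,s_i\rangle+\sum_jp_j\cdot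 s_j$ then $\langle P;Q,s\rangle\to\sum_ip_i\cdot\langle P_i;Q,s_i\rangle+\sum_jp_j\cdot\langle Q,s_j\rangle$ and $\langle P\parallel Q,s\rangle\to\sum_ip_i\cdot\langle P_i\parallel Q,s_i\rangle+\sum_jp_j\cdot\langle Q,s_j\rangle$; symmetrically, if $\langle Q,s\rangle\to\sum_ip_i\cdot\langle Q_i,s_i\rangle+\sum_jp_j\cdot s_j$ then $\langle P\parallel Q,s\rangle\to\sum_ip_i\cdot\langle P\parallel Q_i,s_i\rangle+\sum_jp_j\cdot\langle P,s_j\rangle$; - if $\langle P,s\rangle\to\mu$ and $\langle Q,s\rangle\to\nu$ then $\langle P+_pQ,s\rangle\to p\cdot\mu+(1-p)\cdot\nu$, $\langle P+Q,s\rangle\to\mu$ and $\langle P+Q,s\rangle\to\nu$, where the last two rules need only their own premise; - $\langle\mathtt{if}\ b\ \mathtt{then}\ P\ \mathtt{else}\ Q,s\rangle\to1\cdot\langle P,s\rangle$ if $[\![b]\!](s)=\mathtt{tt}$ and $\to1\cdot\langle Q,s\rangle$ otherwise; $\langle\mathtt{while}\ b\ P,s\rangle\to1\cdot\langle P;\mathtt{while}\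 b\ P,s\rangle$ if $[\![b]\!](s)=\mathtt{tt}$ and $\to1\cdot s$ otherwise. A history is a finite list of pairs in $\mathrm{Conf}\times\mathsf V_{=1,\omega}(S+\mathrm{Conf})$. A (probabilistic) scheduler is a partial function $\mathcal S$ from pairs $(h,c)$ of a history and a configuration to $\mathsf V_{=1,\omega}(S+\mathrm{Conf})$ such that $\mathcal S(h,c)$, when defined, is a convex combination of valuations $\nu$ with $c\to\nu$. The relation $h\,c\Downarrow^{\mathcal S,n}\mu$ ($n$-step partial evaluation) is generated by: $h\,c\Downarrow^{\mathcal S,0}\bot$, where $\bot$ is the zero valuation; and, if $\mathcal S(h,c)=\sum_kp_k\cdot\nu_k$ is such a convex combination, $\nu_k=\sum_ip_{k,i}\cdot c_{k,i}+\sum_jp_{k,j}\cdot s_{k,j}$, and $h\,c\,\nu_k\,c_{k,i}\Downarrow^{\mathcal S,n}\mu_{k,i}$ for all $k,i$, then $h\,c\Downarrow^{\mathcal S,n+1}\sum_kp_k\cdot(\sum_ip_{k,i}\cdot\mu_{k,i}+\sum_jp_{k,j}\cdot s_{k,j})$. With the empty history, $\mathcal S$ is non-blocking for $c$ if for every $n$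 there is $\mu$ with $c\Downarrow^{\mathcal S,n}\mu$. For $U\subseteq S$ and $p\ge 0$ a valuation $\mu$ on $S$ satisfies $\langle p\rangle U$ ("$p$-termination in $U$") if $\mu(U)>p$; finite conjunctions and disjunctions of such formulae are interpreted as usual. A configuration $c$ satisfies $\Diamond\varphi$ if for some scheduler $\mathcal S$ there are $n,\mu$ with $c\Downarrow^{\mathcal S,n}\mu$ and $\mu\models\varphi$; it satisfies $\Box\varphi$ if for every scheduler $\mathcal S$ that is non-blocking for $c$ there are $n,\mu$ with $c\Downarrow^{\mathcal S,n}\mu$ and $\mu\models\varphi$. Finally let $F_0(c)=\{\bot\}$ and, with Minkowski sums, $$F_{n+1}(c)=\bigcup\Big\{\textstyle\sum_ip_i\cdot F_n(c_i)+\sum_jp_j\cdot s_j\ \Big|\ c\to\sum_ip_i\cdot c_i+\sum_jp_j\cdot s_j\Big\}.$$ **Theorem.** Let the states be effectively coded by natural numbers. Assume that every $[\![a]\!]$ is computable with values that are linear combinations with rational coefficients, and that every $[\![b]\!]$ is decidable. Let $P$ be a program. Then the sets $F_n(\langle P,s\rangle)$ are finite and consist of linear combinations with rational coefficients, and a finite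 list of their elements is computable from $n$ and $s$. Moreover, if $U,U_1,\dots,U_k\subseteq S$ are decidable and $p,p_1,\dots,p_k\in[0,1)\cap\mathbb Q$, the following are semi-decidable, with $s$ as input: 1. $\langle P,s\rangle\models\Diamond\langle p\rangle U$ and, more generally, $\langle P,s\rangle\models\Diamond(\langle p_1\rangle U_1\vee\dots\vee\langle p_k\rangle U_k)$; 2. $\langle P,s\rangle\models\Box\langle p\rangle U$ and, more generally, $\langle P,s\rangle\models\Box(\langle p_1\rangle U_1\wedge\dots\wedge\langle p_k\rangle U_k)$. They are semi-decided by exhaustive search in $F_1,F_2,\dots$: for $\varphi$ as in 1, $\langle P,s\rangle\models\Diamond\varphi$ iff for some $n\ge1$ some $\mu\in F_n(\langle P,s\rangle)$ satisfies $\varphi$; for $\varphi$ as in 2, $\langle P,s\rangle\models\Box\varphi$ iff for some $n\ge1$ all $\mu\in F_n(\langle P,s\rangle)$ satisfy $\varphi$; and in both cases the test on $F_n(\langle P,s\rangle)$ is decidable, with $n$ and $s$ as input. If moreover the atomic programs and the conditions are effectively coded by natural numbers, $[\![a]\!](s)$ (with rational coefficients) is computable from $a$ and $s$, and $[\![b]\!](s)$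 is computable from $b$ and $s$, then all of this holds with the program $P$ as part of the input too. -/

import Mathlib

open scoped NNReal
open Convexity

/-! ### Syntax -/

/-- Rational numbers in `[0, 1]`. -/
def RatProb : Type := {p : ℚ≥0 // p ≤ 1}

/-- Programs of concurrent pGCL over a set `A` of atomic programs and a set `B` of conditions. -/
inductive Prog (A B : Type*) where
  | skip : Prog A B
  | atom (a : A) : Prog A B
  | seq (P Q : Prog A B) : Prog A B
  | par (P Q : Prog A B) : Prog A B
  | prob (p : RatProb) (P Q : Prog A B) : Prog A B
  | choice (P Q : Prog A B) : Prog A B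
  | ite (b : B) (P Q : Prog A B) : Prog A B
  | loop (b : B) (P : Prog A B) : Prog A B

/-- Configurations: pairs of a program and a state. -/
abbrev Conf (A B S : Type*) := Prog A B × S

/-! ### Valuations on a discrete space -/

/-- Finite linear combinations of point masses on the discrete space `X`. -/
abbrev Val (X : Type*) := X →₀ ℝ≥0

/-- Finite linear combinations of point masses on the discrete space `X` with total mass `1`. -/
abbrev Val1 (X : Type*) := StdSimplex ℝ≥0 X

/-- The mass `μ(U)` of a set `U`. -/
noncomputable def Val.mass {X : Type*} (μ : Val X) (U : Set X) : ℝ≥0 :=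
  μ.sum fun x r => U.indicator (fun _ => r) x

/-! ### Small-step operational semantics -/

/-- Interpretation of the atomic programs and of the conditions. -/
structure Interp (A B S : Type*) where
  atom : A → S → Val1 S
  cond : B → S → Bool

/-- The outcome of one step: termination in a state, or a configuration to be resumed. -/
abbrev Outcome (A B S : Type*) := S ⊕ Conf A B S

inductive Step {A B S : Type*} (I : Interp A B S) :
    Conf A B S → Val1 (Outcome A B S) → Prop where
  | atom (a : A) (s : S) : Step I (.atom a, s) ((I.atom a s).map Sum.inl)
  | skip (s : S) : Step I (.skip, s) (.single (.inl s))
  | seq {P Q : Prog A B} {s : S} {ν : Val1 (Outcome A B S)} (h : Step I (P, s) ν) :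
      Step I (.seq P Q, s)
        (ν.map (Sum.elim (fun t => .inr (Q, t)) (fun c => .inr (.seq c.1 Q, c.2))))
  | parLeft {P Q : Prog A B} {s : S} {ν : Val1 (Outcome A B S)} (h : Step I (P, s) ν) :
      Step I (.par P Q, s)
        (ν.map (Sum.elim (fun t => .inr (Q, t)) (fun c => .inr (.par c.1 Q, c.2))))
  | parRight {P Q : Prog A B} {s : S} {ν : Val1 (Outcome A B S)} (h : Step I (Q, s) ν) :
      Step I (.par P Q, s)
        (ν.map (Sum.elim (fun t => .inr (P, t)) (fun c => .inr (.par P c.1, c.2))))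
  | prob {p : RatProb} {P Q : Prog A B} {s : S} {μ ν : Val1 (Outcome A B S)}
      (hP : Step I (P, s) μ) (hQ : Step I (Q, s) ν) :
      Step I (.prob p P Q, s)
        (convexCombPair (p.1 : ℝ≥0) (1 - (p.1 : ℝ≥0)) zero_le zero_le
          (add_tsub_cancel_of_le (by exact_mod_cast p.2)) μ ν)
  | choiceLeft {P Q : Prog A B} {s : S} {ν : Val1 (Outcome A B S)} (h : Step I (P, s) ν) :
      Step I (.choice P Q, s) ν
  | choiceRight {P Q : Prog A B} {s : S} {ν : Val1 (Outcome A B S)} (h : Step I (Q, s) ν) :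
      Step I (.choice P Q, s) ν
  | iteTrue {b : B} {P Q : Prog A B} {s : S} (h : I.cond b s = true) :
      Step I (.ite b P Q, s) (.single (.inr (P, s)))
  | iteFalse {b : B} {P Q : Prog A B} {s : S} (h : I.cond b s = false) :
      Step I (.ite b P Q, s) (.single (.inr (Q, s)))
  | loopTrue {b : B} {P : Prog A B} {s : S} (h : I.cond b s = true) :
      Step I (.loop b P, s) (.single (.inr (.seq P (.loop b P), s)))
  | loopFalse {b : B} {P : Prog A B} {s : S} (h : I.cond b s = false) :
      Step I (.loop b P, s) (.single (.inl s))

/-! ### Schedulers and big-step operational semantics -/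

/-- Histories of configurations and of the valuations chosen at them, oldest first. -/
abbrev History (A B S : Type*) := List (Conf A B S × Val1 (Outcome A B S))

/-- A formal convex combination `∑ₖ pₖ · νₖ` all of whose `νₖ` are available at `c`. -/
def Available {A B S : Type*} (I : Interp A B S) (c : Conf A B S)
    (w : Val1 (Val1 (Outcome A B S))) : Prop :=
  ∀ ν ∈ w.weights.support, Step I c ν

/-- Probabilistic schedulers: partial functions on pairs of a history and a configuration whose
values are convex combinations of the valuations available at the configuration. -/
structure Scheduler {A B S : Type*} (I : Interp A B S) where
  run : History A B S → Conf A B S → Option (Val1 (Outcome A B S))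
  convex : ∀ h c μ, run h c = some μ → ∃ w, Available I c w ∧ μ = w.sConvexComb

/-- The valuation `∑ᵢ pᵢ · f(cᵢ) + ∑ⱼ pⱼ · sⱼ`, where `ν = ∑ᵢ pᵢ · cᵢ + ∑ⱼ pⱼ · sⱼ`. -/
noncomputable def collapse {A B S : Type*} (ν : Val1 (Outcome A B S)) (f : Conf A B S → Val S) :
    Val S :=
  ν.weights.sum fun x q => q • Sum.elim (fun s => Finsupp.single s 1) f x

/-- `BigStep σ n h c μ`: the `n`-step partial evaluation of `c` after the history `h` under the
scheduler `σ` yields the valuation `μ`. -/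
inductive BigStep {A B S : Type*} {I : Interp A B S} (σ : Scheduler I) :
    ℕ → History A B S → Conf A B S → Val S → Prop where
  | zero (h : History A B S) (c : Conf A B S) : BigStep σ 0 h c 0
  | succ (n : ℕ) (h : History A B S) (c : Conf A B S) (w : Val1 (Val1 (Outcome A B S)))
      (m : Val1 (Outcome A B S) → Conf A B S → Val S)
      (hw : Available I c w) (hσ : σ.run h c = some w.sConvexComb)
      (hm : ∀ ν ∈ w.weights.support, ∀ c', Sum.inr c' ∈ ν.weights.support →
        BigStep σ n (h ++ [(c, ν)]) c' (m ν c')) :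
      BigStep σ (n + 1) h c (w.weights.sum fun ν p => p • collapse ν (m ν))

/-- `σ` is non-blocking with respect to `c` and the empty history. -/
def NonBlocking {A B S : Type*} {I : Interp A B S} (σ : Scheduler I) (c : Conf A B S) : Prop :=
  ∀ n, ∃ μ, BigStep σ n [] c μ

/-! ### The logic -/

/-- Formulae of the probabilistic layer; `stat p U` is "termination in `U` with probability
strictly greater than `p`". -/
inductive PForm (S : Type*) where
  | stat (p : ℝ≥0) (U : Set S) : PForm S
  | and (φ ψ : PForm S) : PForm S
  | disj (ι : Type) (φ : ι → PForm S) : PForm S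
  | bot : PForm S
  | top : PForm S

/-- Formulae of the non-deterministic layer. -/
inductive Form (S : Type*) where
  | box (φ : PForm S) : Form S
  | dia (φ : PForm S) : Form S
  | and (φ ψ : Form S) : Form S
  | disj (ι : Type) (φ : ι → Form S) : Form S
  | bot : Form S
  | top : Form S

def PForm.Sat {S : Type*} (μ : Val S) : PForm S → Prop
  | .stat p U => p < μ.mass U
  | .and φ ψ => φ.Sat μ ∧ ψ.Sat μ
  | .disj _ φ => ∃ i, (φ i).Sat μ
  | .bot => False
  | .top => True

def Form.Sat {A B S : Type*} (I : Interp A B S) (c : Conf A B S) : Form S → Prop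
  | .box φ => ∀ σ : Scheduler I, NonBlocking σ c → ∃ n μ, BigStep σ n [] c μ ∧ φ.Sat μ
  | .dia φ => ∃ σ : Scheduler I, ∃ n μ, BigStep σ n [] c μ ∧ φ.Sat μ
  | .and φ ψ => φ.Sat I c ∧ ψ.Sat I c
  | .disj _ φ => ∃ i, (φ i).Sat I c
  | .bot => False
  | .top => True

/-- The finite disjunction `φ₀ ∨ ⋯ ∨ φₖ₋₁`. -/
def PForm.finOr {S : Type*} {k : ℕ} (φ : Fin k → PForm S) : PForm S := .disj (Fin k) φ

/-- The finite conjunction `φ₀ ∧ ⋯ ∧ φₖ₋₁`. -/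
def PForm.finAnd {S : Type*} {k : ℕ} (φ : Fin k → PForm S) : PForm S :=
  (List.ofFn φ).foldr .and .top

/-! ### The finite sets searched by the procedure -/

/-- The sets `F₀(c) = {⊥}` and
`Fₙ₊₁(c) = ⋃ {∑ᵢ pᵢ · Fₙ(cᵢ) + ∑ⱼ pⱼ · sⱼ | c ⟶ ∑ᵢ pᵢ · cᵢ + ∑ⱼ pⱼ · sⱼ}` (Minkowski sums). -/
def FSet {A B S : Type*} (I : Interp A B S) : ℕ → Conf A B S → Set (Val S)
  | 0, _ => {0}
  | n + 1, c => {μ | ∃ ν, Step I c ν ∧ ∃ f : Conf A B S → Val S,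
      (∀ c', Sum.inr c' ∈ ν.weights.support → f c' ∈ FSet I n c') ∧ μ = collapse ν f}

/-! ### Computability -/

/-- Finite presentations of linear combinations of point masses with rational coefficients:
an entry `(x, a, b)` stands for `a / (b + 1) · x`. -/
abbrev RatComb (X : Type*) := List (X × ℕ × ℕ)

noncomputable def RatComb.val {X : Type*} (l : RatComb X) : Val X :=
  (l.map fun x => Finsupp.single x.1 ((x.2.1 : ℝ≥0) / ((x.2.2 : ℝ≥0) + 1))).sum

/-- `f` is computable and its values are linear combinations with rational coefficients. -/
def RatComputable {α X : Type*} [Primcodable α] [Primcodable X] (f : α → Val X) : Prop :=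
  ∃ g : α → RatComb X, Computable g ∧ ∀ a, (g a).val = f a

/-- The set-valued map `F` takes finite values, finite lists of which can be computed, in the form
of linear combinations with rational coefficients. -/
def RatFiniteComputable {α X : Type*} [Primcodable α] [Primcodable X] (F : α → Set (Val X)) :
    Prop :=
  ∃ g : α → List (RatComb X), Computable g ∧ ∀ a, F a = {μ | ∃ l ∈ g a, RatComb.val l = μ}

/-- `Q` is semi-decidable, and it is semi-decided by searching exhaustively through `n = 1, 2, …`
for an `n` that passes the decidable test `T n`. -/
def SemiDecidableBySearch {α : Type*} [Primcodable α] (Q : α → Prop) (T : ℕ → α → Prop) : Prop :=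
  REPred Q ∧ ComputablePred (fun x : ℕ × α => T x.1 x.2) ∧ ∀ a, Q a ↔ ∃ n, 1 ≤ n ∧ T n a

/-- May statistical termination `◇φ` of the configurations `conf a` is semi-decidable in `a`, by a
search for an `n` such that some valuation in `Fₙ` satisfies `φ`. -/
def MaySemiDecidable {A B S α : Type*} [Primcodable α] (I : Interp A B S)
    (conf : α → Conf A B S) (φ : PForm S) : Prop :=
  SemiDecidableBySearch (fun a => (Form.dia φ).Sat I (conf a))
    (fun n a => ∃ μ ∈ FSet I n (conf a), φ.Sat μ)

/-- Must statistical termination `□φ` of the configurations `conf a` is semi-decidable in `a`, by a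
search for an `n` such that all valuations in `Fₙ` satisfy `φ`. -/
def MustSemiDecidable {A B S α : Type*} [Primcodable α] (I : Interp A B S)
    (conf : α → Conf A B S) (φ : PForm S) : Prop :=
  SemiDecidableBySearch (fun a => (Form.box φ).Sat I (conf a))
    (fun n a => ∀ μ ∈ FSet I n (conf a), φ.Sat μ)

/-- For the configurations `conf a`, with `a` as input: the sets `Fₙ` are finite and computable,
and the four kinds of statistical termination are semi-decidable. -/
def StatisticalTerminationSemiDecidable {A B S α : Type*} [Primcodable S] [Primcodable α]
    (I : Interp A B S) (conf : α → Conf A B S) : Prop :=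
  RatFiniteComputable (fun x : ℕ × α => FSet I x.1 (conf x.2)) ∧
  (∀ (p : ℚ≥0) (U : Set S), p < 1 → ComputablePred (fun s => s ∈ U) →
    MaySemiDecidable I conf (.stat (p : ℝ≥0) U) ∧
    MustSemiDecidable I conf (.stat (p : ℝ≥0) U)) ∧
  (∀ (k : ℕ) (p : Fin k → ℚ≥0) (U : Fin k → Set S), (∀ i, p i < 1) →
    (∀ i, ComputablePred (fun s => s ∈ U i)) →
    MaySemiDecidable I conf (.finOr fun i => .stat (p i : ℝ≥0) (U i)) ∧
    MustSemiDecidable I conf (.finAnd fun i => .stat (p i : ℝ≥0) (U i)))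

/-! ### Programs as finite data

The elements of `RatProb` are coded by reduced fractions, and programs by their words in prefix
(Polish) notation. -/

/-- Reduced fractions with value in `[0, 1]`. -/
def IsRedFrac (x : ℕ × ℕ) : Prop := x.2 ≠ 0 ∧ x.1 ≤ x.2 ∧ Nat.Coprime x.1 x.2

instance : DecidablePred IsRedFrac := fun _ => inferInstanceAs (Decidable (_ ∧ _ ∧ _))

theorem isRedFrac_iff (x : ℕ × ℕ) : IsRedFrac x ↔
    (x.2 ≠ 0 ∧ x.1 ≤ x.2) ∧ ∀ d < x.2 + 1, (x.1 % d ≠ 0 ∨ x.2 % d ≠ 0) ∨ d = 1 := by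
  unfold IsRedFrac
  rw [and_assoc]
  refine and_congr_right fun h0 => and_congr_right fun _ => ?_
  rw [Nat.coprime_iff_gcd_eq_one]
  constructor
  · intro h d _
    by_contra hd
    push Not at hd
    obtain ⟨⟨h1, h2⟩, h3⟩ := hd
    have := Nat.dvd_gcd (Nat.dvd_of_mod_eq_zero h1) (Nat.dvd_of_mod_eq_zero h2)
    rw [h] at this
    exact h3 (Nat.dvd_one.1 this)
  · intro h
    rcases h (Nat.gcd x.1 x.2)
      (Nat.lt_succ_of_le (Nat.le_of_dvd (Nat.pos_of_ne_zero h0) (Nat.gcd_dvd_right _ _)))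
      with (h | h) | h
    · exact absurd (Nat.mod_eq_zero_of_dvd (Nat.gcd_dvd_left _ _)) h
    · exact absurd (Nat.mod_eq_zero_of_dvd (Nat.gcd_dvd_right _ _)) h
    · exact h

theorem isRedFrac_primrec : PrimrecPred IsRedFrac := by
  have e : PrimrecRel fun (d : ℕ) (x : ℕ × ℕ) => (x.1 % d ≠ 0 ∨ x.2 % d ≠ 0) ∨ d = 1 := by
    have a1 : PrimrecPred fun y : ℕ × (ℕ × ℕ) => y.2.1 % y.1 = 0 :=
      Primrec.eq.comp (Primrec.nat_mod.comp (Primrec.fst.comp Primrec.snd) Primrec.fst)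
        (Primrec.const 0)
    have a2 : PrimrecPred fun y : ℕ × (ℕ × ℕ) => y.2.2 % y.1 = 0 :=
      Primrec.eq.comp (Primrec.nat_mod.comp (Primrec.snd.comp Primrec.snd) Primrec.fst)
        (Primrec.const 0)
    have a3 : PrimrecPred fun y : ℕ × (ℕ × ℕ) => y.1 = 1 :=
      Primrec.eq.comp Primrec.fst (Primrec.const 1)
    exact (a1.not.or a2.not).or a3
  have b : PrimrecPred fun x : ℕ × ℕ => x.2 ≠ 0 ∧ x.1 ≤ x.2 :=
    (Primrec.eq.comp Primrec.snd (Primrec.const 0)).not.and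
      (Primrec.nat_le.comp Primrec.fst Primrec.snd)
  have c : PrimrecPred fun x : ℕ × ℕ =>
      ∀ d < x.2 + 1, (x.1 % d ≠ 0 ∨ x.2 % d ≠ 0) ∨ d = 1 :=
    (PrimrecRel.comp (R := fun (L : List ℕ) (x : ℕ × ℕ) =>
        ∀ d ∈ L, (x.1 % d ≠ 0 ∨ x.2 % d ≠ 0) ∨ d = 1)
      (f := fun x : ℕ × ℕ => List.range (x.2 + 1)) (g := fun x => x) e.forall_mem_list
      (Primrec.list_range.comp (Primrec.succ.comp Primrec.snd)) Primrec.id).of_eq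
      fun x => by simp only [List.mem_range]
  exact (b.and c).of_eq fun x => (isRedFrac_iff x).symm

/-- The lowest-terms representation. -/
def RatProb.equivFrac : RatProb ≃ {x : ℕ × ℕ // IsRedFrac x} where
  toFun p := ⟨(p.1.num, p.1.den), p.1.den_ne_zero,
    by
      have h := p.2
      rw [← NNRat.num_div_den p.1, div_le_one (by exact_mod_cast p.1.den_pos)] at h
      exact_mod_cast h, p.1.coprime_num_den⟩
  invFun x := ⟨(x.1.1 : ℚ≥0) / x.1.2,
    div_le_one_of_le₀ (by exact_mod_cast x.2.2.1) zero_le⟩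
  left_inv p := Subtype.ext (NNRat.num_div_den p.1)
  right_inv x := by
    obtain ⟨⟨a, b⟩, h0, h1, h2⟩ := x
    have hb : (0 : ℤ) < b := by exact_mod_cast Nat.pos_of_ne_zero h0
    have e : (((a : ℚ≥0) / b : ℚ≥0) : ℚ) = ((a : ℤ) : ℚ) / ((b : ℤ) : ℚ) := by push_cast; rfl
    refine Subtype.ext (Prod.ext ?_ ?_)
    · have h := Rat.num_div_eq_of_coprime (a := a) (b := b) hb (by simpa using h2)
      rw [← e] at h
      change ((a : ℚ≥0) / b : ℚ≥0).num = a
      rw [← NNRat.natAbs_num_coe, h, Int.natAbs_natCast]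
    · have h := Rat.den_div_eq_of_coprime (a := a) (b := b) hb (by simpa using h2)
      rw [← e, NNRat.den_coe] at h
      exact_mod_cast h

instance : Primcodable RatProb :=
  haveI : Primcodable {x : ℕ × ℕ // IsRedFrac x} := Primcodable.subtype isRedFrac_primrec
  Primcodable.ofEquiv _ RatProb.equivFrac

/-- Letters of the prefix notation: `(b, true)` is `if b`, `(b, false)` is `while b`, and the
elements `0, 1, 2, 3` of `Fin 4` are `skip`, `;`, `∥`, `+`. -/
abbrev Letter (A B : Type*) := A ⊕ (B × Bool) ⊕ RatProb ⊕ Fin 4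

namespace Prog

variable {A B : Type*}

def word : Prog A B → List (Letter A B)
  | skip => [.inr (.inr (.inr 0))]
  | atom a => [.inl a]
  | seq P Q => .inr (.inr (.inr 1)) :: (P.word ++ Q.word)
  | par P Q => .inr (.inr (.inr 2)) :: (P.word ++ Q.word)
  | prob p P Q => .inr (.inr (.inl p)) :: (P.word ++ Q.word)
  | choice P Q => .inr (.inr (.inr 3)) :: (P.word ++ Q.word)
  | ite b P Q => .inr (.inl (b, true)) :: (P.word ++ Q.word)
  | loop b P => .inr (.inl (b, false)) :: P.word

/-- The number of arguments of a letter. -/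
def arity : Letter A B → ℕ
  | .inl _ => 0
  | .inr (.inl x) => bif x.2 then 2 else 1
  | .inr (.inr (.inl _)) => 2
  | .inr (.inr (.inr i)) => if i = 0 then 0 else 2

/-- Reading a letter, from the right, with the given stack of programs. -/
def push : Letter A B → List (Prog A B) → Option (List (Prog A B))
  | .inl a, st => some (atom a :: st)
  | .inr (.inl (b, true)), P :: Q :: st => some (ite b P Q :: st)
  | .inr (.inl (b, false)), P :: st => some (loop b P :: st)
  | .inr (.inr (.inl p)), P :: Q :: st => some (prob p P Q :: st)
  | .inr (.inr (.inr 0)), st => some (skip :: st)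
  | .inr (.inr (.inr 1)), P :: Q :: st => some (seq P Q :: st)
  | .inr (.inr (.inr 2)), P :: Q :: st => some (par P Q :: st)
  | .inr (.inr (.inr 3)), P :: Q :: st => some (choice P Q :: st)
  | _, _ => none

def parse (l : List (Letter A B)) : Option (List (Prog A B)) :=
  l.foldr (fun t o => o.bind (push t)) (some [])

/-- The height of the stack of `parse`. -/
def height (l : List (Letter A B)) : Option ℕ :=
  l.foldr (fun t o => o.bind fun n => if arity t ≤ n then some (n - arity t + 1) else none)
    (some 0)

theorem parse_word (P : Prog A B) (l : List (Letter A B)) :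
    parse (P.word ++ l) = (parse l).map (P :: ·) := by
  induction P generalizing l with
  | skip => cases h : parse l <;> simp_all [word, parse, push]
  | atom a => cases h : parse l <;> simp_all [word, parse, push]
  | seq P Q hP hQ | par P Q hP hQ | prob p P Q hP hQ | choice P Q hP hQ | ite b P Q hP hQ =>
    simp only [word, List.cons_append, List.append_assoc]
    rw [parse, List.foldr_cons, ← parse, hP, hQ]
    cases parse l <;> simp [push]
  | loop b P hP =>
    simp only [word, List.cons_append]
    rw [parse, List.foldr_cons, ← parse, hP]
    cases parse l <;> simp [push]

theorem height_push (t : Letter A B) (st : List (Prog A B)) :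
    (push t st).map List.length =
      if arity t ≤ st.length then some (st.length - arity t + 1) else none := by
  rcases t with a | ⟨b, _ | _⟩ | p | i
  · simp [push, arity]
  · rcases st with _ | ⟨P, st⟩ <;> simp [push, arity]
  · rcases st with _ | ⟨P, _ | ⟨Q, st⟩⟩ <;> simp [push, arity]
  · rcases st with _ | ⟨P, _ | ⟨Q, st⟩⟩ <;> simp [push, arity]
  · fin_cases i <;> rcases st with _ | ⟨P, _ | ⟨Q, st⟩⟩ <;> simp [push, arity]

theorem height_eq (l : List (Letter A B)) : height l = (parse l).map List.length := by
  induction l with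
  | nil => simp [height, parse]
  | cons t l ih =>
    rw [height, List.foldr_cons, ← height, ih]
    conv_rhs => rw [parse, List.foldr_cons, ← parse]
    cases parse l with
    | none => simp
    | some st => simpa using (height_push t st).symm

theorem word_push (t : Letter A B) (st st' : List (Prog A B)) (h : push t st = some st') :
    t :: st.flatMap word = st'.flatMap word := by
  rcases t with a | ⟨b, _ | _⟩ | p | i
  · simp only [push, Option.some.injEq] at h; subst h; simp [word]
  · rcases st with _ | ⟨P, st⟩ <;> simp only [push, Option.some.injEq, reduceCtorEq] at h
    subst h; simp [word]
  · rcases st with _ | ⟨P, _ | ⟨Q, st⟩⟩ <;> simp only [push, Option.some.injEq, reduceCtorEq] at h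
    subst h; simp [word]
  · rcases st with _ | ⟨P, _ | ⟨Q, st⟩⟩ <;> simp only [push, Option.some.injEq, reduceCtorEq] at h
    subst h; simp [word]
  · fin_cases i <;> rcases st with _ | ⟨P, _ | ⟨Q, st⟩⟩ <;> simp [push] at h <;> subst h <;>
      simp [word]

theorem word_parse (l : List (Letter A B)) (st : List (Prog A B)) (h : parse l = some st) :
    l = st.flatMap word := by
  induction l generalizing st with
  | nil => simp only [parse, List.foldr_nil, Option.some.injEq] at h; subst h; rfl
  | cons t l ih =>
    rw [parse, List.foldr_cons, ← parse] at h
    obtain ⟨st', h1, h2⟩ := Option.bind_eq_some_iff.1 h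
    rw [ih st' h1, word_push t st' st h2]

theorem height_word (P : Prog A B) : height P.word = some 1 := by
  have := parse_word P []
  rw [List.append_nil] at this
  rw [height_eq, this]
  rfl

/-- Programs correspond to the well-formed words of the prefix notation. -/
noncomputable def equivWord : Prog A B ≃ {l : List (Letter A B) // height l = some 1} :=
  Equiv.ofBijective (fun P => ⟨P.word, height_word P⟩) <| by
    constructor
    · intro P Q h
      have h1 := parse_word P []
      have h2 := parse_word Q []
      rw [List.append_nil] at h1 h2
      rw [Subtype.mk.injEq] at h
      rw [h, h2] at h1
      simpa [parse] using h1.symm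
    · rintro ⟨l, hl⟩
      rw [height_eq, Option.map_eq_some_iff] at hl
      obtain ⟨st, h1, h2⟩ := hl
      obtain ⟨P, rfl⟩ := List.length_eq_one_iff.1 h2
      exact ⟨P, Subtype.ext (by simpa using (word_parse l _ h1).symm)⟩

theorem height_primrec [Primcodable A] [Primcodable B] :
    Primrec (height : List (Letter A B) → Option ℕ) := by
  have har : Primrec (arity : Letter A B → ℕ) := by
    have h : Primrec fun t : Letter A B => Sum.casesOn (motive := fun _ => ℕ) t (fun _ => 0)
        fun u => Sum.casesOn (motive := fun _ => ℕ) u (fun x => bif x.2 then 2 else 1)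
          fun v => Sum.casesOn (motive := fun _ => ℕ) v (fun _ => 2)
            fun i => if i = 0 then 0 else 2 := by
      refine Primrec.sumCasesOn Primrec.id (Primrec.const 0).to₂ ?_
      refine Primrec.sumCasesOn Primrec.snd
        (Primrec.cond (Primrec.snd.comp Primrec.snd) (Primrec.const 2) (Primrec.const 1)).to₂ ?_
      refine Primrec.sumCasesOn Primrec.snd (Primrec.const 2).to₂ ?_
      exact ((Primrec.dom_finite fun i : Fin 4 => if i = 0 then 0 else 2).comp Primrec.snd).to₂
    refine h.of_eq fun t => ?_
    rcases t with a | x | p | i <;> rfl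
  have hstep : Primrec fun x : (Letter A B × Option ℕ) × ℕ =>
      if arity x.1.1 ≤ x.2 then some (x.2 - arity x.1.1 + 1) else none := by
    have h1 : Primrec fun x : (Letter A B × Option ℕ) × ℕ => arity x.1.1 :=
      har.comp (Primrec.fst.comp Primrec.fst)
    exact Primrec.ite (Primrec.nat_le.comp h1 Primrec.snd)
      (Primrec.option_some.comp (Primrec.succ.comp (Primrec.nat_sub.comp Primrec.snd h1)))
      (Primrec.const none)
  have h2 : Primrec fun x : Letter A B × Option ℕ => x.2.bind fun n =>
      if arity x.1 ≤ n then some (n - arity x.1 + 1) else none :=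
    Primrec.option_bind Primrec.snd hstep.to₂
  exact Primrec.list_foldr Primrec.id (Primrec.const (some 0)) (h2.comp Primrec.snd).to₂

noncomputable instance [Primcodable A] [Primcodable B] : Primcodable (Prog A B) :=
  haveI : Primcodable {l : List (Letter A B) // height l = some 1} :=
    Primcodable.subtype (Primrec.eq.comp height_primrec (Primrec.const (some 1)))
  Primcodable.ofEquiv _ equivWord

end Prog

/-! ### Finitely many steps -/

/-! Two facts about the operational semantics do the work: every configuration has at least one and
only finitely many steps, and the mass of a fixed set `U` is a linear functional of the valuation.

By linearity, optimising the mass of `U` over `n` steps is a finite-horizon decision problem solved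
by backward induction: with `n + 1` steps to go, choose the step with the best expected payoff, a
configuration paying its optimal `n`-step value. The result `iterValue` lies in `FSet`, comes from a
deterministic scheduler, and is optimal both in `FSet` and among all evaluations by schedulers,
since averaging over steps and looking at the history cannot beat the best step. So `FSet` and the
schedulers have the same extremal masses.

For `◇` (`dia_iff_exists_FSet`) a disjunction is witnessed by one disjunct, so maximising a single
mass suffices. For `□` (`box_iff_exists_FSet`), let `vₙ(c)` be the minimal `n`-step mass of `U`. It
increases in `n` and is bounded by `1`; let `v(c)` be its limit. Finite branching gives a step at
`c` whose expected payoff with respect to `v` is at most `v(c)` (`exists_memoryless`). Always taking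
such steps is a non-blocking scheduler that never exceeds `v`. Hence, if `□` of the conjunction
holds, `v(c) > pᵢ` for every conjunct, so each has its own sufficient `n`, and by monotonicity a
common larger one serves the finitely many conjuncts. Conversely, if all of `Fₙ` satisfies the
conjunction, each minimal strategy does, and it bounds the mass under any non-blocking scheduler
from below.

It remains to compute `Fₙ`. The steps of a program are found by a stack-based fold over its prefix
notation (`foldr_pushSteps_word`), and `Fₙ` by expanding combinations of outcomes `n` times
(`exists_mem_expandIter_iff`). For a fixed program without codes for the atomic programs and
conditions, the finitely many that occur are numbered; an injective renaming does not change `Fₙ`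
(`FSet_map`). -/

theorem finite_setOf_step {A B S : Type*} (I : Interp A B S) (c : Conf A B S) :
    {ν | Step I c ν}.Finite := by
  obtain ⟨P, s⟩ := c
  induction P generalizing s with
  | skip =>
    refine (Set.finite_singleton (.single (.inl s))).subset ?_
    intro ν h; cases h; rfl
  | atom a =>
    refine (Set.finite_singleton ((I.atom a s).map Sum.inl)).subset ?_
    intro ν h; cases h; rfl
  | seq P Q hP hQ =>
    refine ((hP s).image fun ν => ν.map
      (Sum.elim (fun t => .inr (Q, t)) (fun c => .inr (.seq c.1 Q, c.2)))).subset ?_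
    intro ν h; cases h with | seq h => exact ⟨_, h, rfl⟩
  | par P Q hP hQ =>
    refine (((hP s).image fun ν => ν.map
      (Sum.elim (fun t => .inr (Q, t)) (fun c => .inr (.par c.1 Q, c.2)))).union
      ((hQ s).image fun ν => ν.map
      (Sum.elim (fun t => .inr (P, t)) (fun c => .inr (.par P c.1, c.2))))).subset ?_
    intro ν h
    cases h with
    | parLeft h => exact .inl ⟨_, h, rfl⟩
    | parRight h => exact .inr ⟨_, h, rfl⟩
  | prob p P Q hP hQ =>
    refine ((hP s).image2 (fun μ ν => convexCombPair (p.1 : ℝ≥0) (1 - (p.1 : ℝ≥0)) zero_le zero_le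
      (add_tsub_cancel_of_le (by exact_mod_cast p.2)) μ ν) (hQ s)).subset ?_
    intro ν h; cases h with | prob h1 h2 => exact ⟨_, h1, _, h2, rfl⟩
  | choice P Q hP hQ =>
    refine ((hP s).union (hQ s)).subset ?_
    intro ν h
    cases h with
    | choiceLeft h => exact .inl h
    | choiceRight h => exact .inr h
  | ite b P Q hP hQ =>
    refine (Set.toFinite {.single (.inr (P, s)), .single (.inr (Q, s))}).subset ?_
    intro ν h; cases h <;> simp
  | loop b P hP =>
    refine (Set.toFinite {.single (.inr (.seq P (.loop b P), s)), .single (.inl s)}).subset ?_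
    intro ν h; cases h <;> simp

/-- Progress: since no configuration is stuck, strategies are total and the schedulers built from
them never block. -/
theorem exists_step {A B S : Type*} (I : Interp A B S) (c : Conf A B S) :
    {ν | Step I c ν}.Nonempty := by
  obtain ⟨P, s⟩ := c
  induction P generalizing s with
  | skip => exact ⟨_, .skip s⟩
  | atom a => exact ⟨_, .atom a s⟩
  | seq P Q hP hQ => exact ⟨_, .seq (hP s).choose_spec⟩
  | par P Q hP hQ => exact ⟨_, .parLeft (hP s).choose_spec⟩
  | prob p P Q hP hQ => exact ⟨_, .prob (hP s).choose_spec (hQ s).choose_spec⟩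
  | choice P Q hP hQ => exact ⟨_, .choiceLeft (hP s).choose_spec⟩
  | ite b P Q hP hQ =>
    cases h : I.cond b s
    · exact ⟨_, .iteFalse h⟩
    · exact ⟨_, .iteTrue h⟩
  | loop b P hP =>
    cases h : I.cond b s
    · exact ⟨_, .loopFalse h⟩
    · exact ⟨_, .loopTrue h⟩

theorem FSet_nonempty {A B S : Type*} (I : Interp A B S) (n : ℕ) (c : Conf A B S) :
    (FSet I n c).Nonempty := by
  induction n generalizing c with
  | zero => exact ⟨0, rfl⟩
  | succ n ih =>
    obtain ⟨ν, hν⟩ := exists_step I c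
    exact ⟨_, ν, hν, fun c' => (ih c').choose, fun c' _ => (ih c').choose_spec, rfl⟩

/-! ### Masses and expected payoffs as linear functionals -/

/-- The mass of `U` as a linear functional. -/
noncomputable def massLinear {X : Type*} (U : Set X) : Val X →ₗ[ℝ≥0] ℝ≥0 :=
  Finsupp.linearCombination ℝ≥0 (U.indicator fun _ => (1 : ℝ≥0))

theorem Val.mass_eq {X : Type*} (μ : Val X) (U : Set X) : μ.mass U = massLinear U μ := by
  classical
  simp [Val.mass, massLinear, Finsupp.linearCombination_apply, Set.indicator_apply]

/-- The expected payoff of a valuation on outcomes, when termination in `U` pays `1` and the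
configuration `c` pays `u c`. -/
noncomputable def payoff {A B S : Type*} (U : Set S) (u : Conf A B S → ℝ≥0) :
    Val (Outcome A B S) →ₗ[ℝ≥0] ℝ≥0 :=
  Finsupp.linearCombination ℝ≥0 (Sum.elim (U.indicator fun _ => (1 : ℝ≥0)) u)

section Semantics

variable {A B S : Type*}

theorem payoff_apply (U : Set S) (u : Conf A B S → ℝ≥0) (ν : Val (Outcome A B S)) :
    payoff U u ν = ∑ x ∈ ν.support, ν x * Sum.elim (U.indicator fun _ => (1 : ℝ≥0)) u x := by
  simp [payoff, Finsupp.linearCombination_apply, Finsupp.sum]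

theorem collapse_eq_linearCombination (ν : Val1 (Outcome A B S)) (f : Conf A B S → Val S) :
    collapse ν f =
      Finsupp.linearCombination ℝ≥0 (Sum.elim (fun s => Finsupp.single s 1) f) ν.weights :=
  rfl

/-- Linearity of the mass. It lets the optimisation be carried out with numbers in place of
valuations. -/
theorem mass_collapse (U : Set S) (ν : Val1 (Outcome A B S)) (f : Conf A B S → Val S) :
    (collapse ν f).mass U = payoff U (fun c => (f c).mass U) ν.weights := by
  rw [Val.mass_eq, collapse_eq_linearCombination, payoff, Finsupp.apply_linearCombination]
  congr 2
  funext x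
  rcases x with s | c
  · simp [massLinear]
  · simp [Val.mass_eq]

theorem payoff_mono (U : Set S) {u v : Conf A B S → ℝ≥0} (ν : Val (Outcome A B S))
    (h : ∀ c, Sum.inr c ∈ ν.support → u c ≤ v c) : payoff U u ν ≤ payoff U v ν := by
  rw [payoff_apply, payoff_apply]
  refine Finset.sum_le_sum fun x hx => mul_le_mul_right ?_ _
  rcases x with s | c
  · rfl
  · exact h c hx

theorem payoff_le_one (U : Set S) {u : Conf A B S → ℝ≥0} (hu : ∀ c, u c ≤ 1)
    (ν : Val1 (Outcome A B S)) : payoff U u ν.weights ≤ 1 := by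
  classical
  rw [payoff_apply, ← ν.total]
  refine Finset.sum_le_sum fun x _ => mul_le_of_le_one_right' ?_
  rcases x with s | c
  · simp only [Sum.elim_inl, Set.indicator_apply]; split_ifs <;> simp
  · exact hu c

theorem mass_bigStep_sum (U : Set S) (w : Val1 (Val1 (Outcome A B S)))
    (m : Val1 (Outcome A B S) → Conf A B S → Val S) :
    Val.mass (w.weights.sum fun ν p => p • collapse ν (m ν)) U =
      ∑ ν ∈ w.weights.support, w.weights ν * payoff U (fun c => (m ν c).mass U) ν.weights := by
  simp only [Val.mass_eq, Finsupp.sum, map_sum, map_smul, smul_eq_mul]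
  refine Finset.sum_congr rfl fun ν _ => ?_
  rw [← Val.mass_eq, mass_collapse]
  simp only [Val.mass_eq]

theorem payoff_sConvexComb (U : Set S) (u : Conf A B S → ℝ≥0)
    (w : Val1 (Val1 (Outcome A B S))) :
    payoff U u w.sConvexComb.weights =
      ∑ ν ∈ w.weights.support, w.weights ν * payoff U u ν.weights := by
  simp [Finsupp.sum, map_sum]

theorem sum_weights_mul {X : Type*} (w : Val1 X) (a : ℝ≥0) :
    ∑ x ∈ w.weights.support, w.weights x * a = a := by
  rw [← Finset.sum_mul]
  have := w.total
  rw [Finsupp.sum] at this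
  rw [this, one_mul]

/-! ### Optimal strategies for finitely many steps -/

/-- The value of the strategy that, with `n + 1` steps to go, chooses by `sel`, given the payoffs
of the configurations with `n` steps to go. -/
noncomputable def iterValue (U : Set S)
    (sel : (Conf A B S → ℝ≥0) → Conf A B S → Val1 (Outcome A B S)) : ℕ → Conf A B S → Val S
  | 0, _ => 0
  | n + 1, c => collapse (sel (fun c' => (iterValue U sel n c').mass U) c) (iterValue U sel n)

section Strategies

variable {I : Interp A B S} {U : Set S}
  {sel : (Conf A B S → ℝ≥0) → Conf A B S → Val1 (Outcome A B S)}

theorem mass_iterValue_zero (c : Conf A B S) : (iterValue U sel 0 c).mass U = 0 := by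
  simp [iterValue, Val.mass_eq]

/-- The Bellman equation, with `sel` as the rule for choosing a step from the current payoffs. -/
theorem mass_iterValue_succ (n : ℕ) (c : Conf A B S) :
    (iterValue U sel (n + 1) c).mass U = payoff U (fun c' => (iterValue U sel n c').mass U)
      (sel (fun c' => (iterValue U sel n c').mass U) c).weights := by
  rw [iterValue, mass_collapse]

theorem iterValue_mem_FSet (hsel : ∀ u c, Step I c (sel u c)) (n : ℕ) (c : Conf A B S) :
    iterValue U sel n c ∈ FSet I n c := by
  induction n generalizing c with
  | zero => rfl
  | succ n ih => exact ⟨_, hsel _ c, _, fun c' _ => ih c', rfl⟩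

theorem mass_le_iterValue_of_mem_FSet
    (hmax : ∀ u c ν, Step I c ν → payoff U u ν.weights ≤ payoff U u (sel u c).weights)
    {n : ℕ} {c : Conf A B S} {μ : Val S} (h : μ ∈ FSet I n c) :
    μ.mass U ≤ (iterValue U sel n c).mass U := by
  induction n generalizing c μ with
  | zero => cases h; simp [Val.mass_eq]
  | succ n ih =>
    obtain ⟨ν, hν, f, hf, rfl⟩ := h
    rw [mass_collapse, mass_iterValue_succ]
    exact (payoff_mono U _ fun c' hc' => ih (hf c' hc')).trans (hmax _ _ _ hν)

theorem iterValue_le_mass_of_mem_FSet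
    (hmin : ∀ u c ν, Step I c ν → payoff U u (sel u c).weights ≤ payoff U u ν.weights)
    {n : ℕ} {c : Conf A B S} {μ : Val S} (h : μ ∈ FSet I n c) :
    (iterValue U sel n c).mass U ≤ μ.mass U := by
  induction n generalizing c μ with
  | zero => simp [mass_iterValue_zero]
  | succ n ih =>
    obtain ⟨ν, hν, f, hf, rfl⟩ := h
    rw [mass_collapse, mass_iterValue_succ]
    exact (hmin _ _ _ hν).trans (payoff_mono U _ fun c' hc' => ih (hf c' hc'))

/-- Neither randomisation nor memory helps: the mass is a weighted average of payoffs of available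
steps, each bounded by the best one, and the induction runs over all histories. -/
theorem mass_le_iterValue_of_bigStep
    (hmax : ∀ u c ν, Step I c ν → payoff U u ν.weights ≤ payoff U u (sel u c).weights)
    {σ : Scheduler I} {n : ℕ} {h : History A B S} {c : Conf A B S} {μ : Val S}
    (H : BigStep σ n h c μ) : μ.mass U ≤ (iterValue U sel n c).mass U := by
  induction H with
  | zero => simp [Val.mass_eq]
  | succ n h c w m hw hσ hm ih =>
    rw [mass_bigStep_sum, mass_iterValue_succ,
      ← sum_weights_mul w (payoff U _ (sel _ c).weights)]
    refine Finset.sum_le_sum fun ν hν => mul_le_mul_right ?_ _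
    exact (payoff_mono U _ fun c' hc' => ih ν hν c' hc').trans (hmax _ _ _ (hw ν hν))

theorem iterValue_le_mass_of_bigStep
    (hmin : ∀ u c ν, Step I c ν → payoff U u (sel u c).weights ≤ payoff U u ν.weights)
    {σ : Scheduler I} {n : ℕ} {h : History A B S} {c : Conf A B S} {μ : Val S}
    (H : BigStep σ n h c μ) : (iterValue U sel n c).mass U ≤ μ.mass U := by
  induction H with
  | zero => simp [mass_iterValue_zero]
  | succ n h c w m hw hσ hm ih =>
    rw [mass_bigStep_sum, mass_iterValue_succ,
      ← sum_weights_mul w (payoff U _ (sel _ c).weights)]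
    refine Finset.sum_le_sum fun ν hν => mul_le_mul_right ?_ _
    exact (hmin _ _ _ (hw ν hν)).trans (payoff_mono U _ fun c' hc' => ih ν hν c' hc')

theorem eq_of_mem_support_single {X : Type*} {x y : X}
    (h : y ∈ (StdSimplex.single (R := ℝ≥0) x).weights.support) : y = x := by
  simpa [eq_comm] using h

/-- The deterministic scheduler given by a choice of steps depending on the length of the history
and on the configuration. -/
def Scheduler.ofChoice (g : ℕ → Conf A B S → Val1 (Outcome A B S))
    (hg : ∀ n c, Step I c (g n c)) : Scheduler I where
  run h c := some (g h.length c)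
  convex h c μ e := by
    refine ⟨.single (g h.length c), fun ν hν => ?_, by simpa using e.symm⟩
    rw [eq_of_mem_support_single hν]
    exact hg _ _

theorem BigStep.ofChoice {g : ℕ → Conf A B S → Val1 (Outcome A B S)}
    {hg : ∀ n c, Step I c (g n c)} {n : ℕ} {h : History A B S} {c : Conf A B S}
    {f : Conf A B S → Val S}
    (hf : ∀ c', BigStep (Scheduler.ofChoice g hg) n (h ++ [(c, g h.length c)]) c' (f c')) :
    BigStep (Scheduler.ofChoice g hg) (n + 1) h c (collapse (g h.length c) f) := by
  -- The point mass at the chosen step serves as the formal convex combination, so the outer sum has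
  -- one term.
  have := BigStep.succ (σ := Scheduler.ofChoice g hg) n h c (.single (g h.length c)) (fun _ => f)
    (fun ν hν => by rw [eq_of_mem_support_single hν]; exact hg _ _) (by simp [Scheduler.ofChoice])
    (fun ν hν c' _ => by rw [eq_of_mem_support_single hν]; exact hf c')
  simpa using this

theorem exists_bigStep_iterValue (hsel : ∀ u c, Step I c (sel u c)) (n : ℕ) (c : Conf A B S) :
    ∃ σ : Scheduler I, BigStep σ n [] c (iterValue U sel n c) := by
  -- The length of the history is the number of steps already made; at length `k`, `n - (k + 1)`
  -- steps remain after the present one, and `sel` receives the values for that horizon.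
  refine ⟨Scheduler.ofChoice
    (fun k c => sel (fun c' => (iterValue U sel (n - (k + 1)) c').mass U) c)
    (fun _ _ => hsel _ _), ?_⟩
  suffices H : ∀ k ≤ n, ∀ (h : History A B S) (c : Conf A B S), h.length = n - k →
      BigStep (Scheduler.ofChoice
        (fun k c => sel (fun c' => (iterValue U sel (n - (k + 1)) c').mass U) c)
        (fun _ _ => hsel _ _)) k h c (iterValue U sel k c) from H n le_rfl [] c (by simp)
  intro k
  induction k with
  | zero => intro _ h c _; exact .zero h c
  | succ k ih =>
    intro hk h c hl
    have e : n - (h.length + 1) = k := by omega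
    rw [iterValue]
    convert! BigStep.ofChoice (f := iterValue U sel k) ?_ using 2
    · simp only [e]
    · intro c'
      exact ih (by omega) _ _ (by simp; omega)

theorem mass_iterValue_le_one (n : ℕ) (c : Conf A B S) : (iterValue U sel n c).mass U ≤ 1 := by
  induction n generalizing c with
  | zero => simp [mass_iterValue_zero]
  | succ n ih => rw [mass_iterValue_succ]; exact payoff_le_one U ih _

/-- Induction on the horizon: the step that is optimal for the longer horizon is a competitor for
the shorter one, where by hypothesis the payoffs are smaller. -/
theorem monotone_mass_iterValue (hsel : ∀ u c, Step I c (sel u c))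
    (hmin : ∀ u c ν, Step I c ν → payoff U u (sel u c).weights ≤ payoff U u ν.weights)
    (c : Conf A B S) : Monotone fun n => (iterValue U sel n c).mass U := by
  refine monotone_nat_of_le_succ fun n => ?_
  induction n generalizing c with
  | zero => simp [mass_iterValue_zero]
  | succ n ih =>
    rw [mass_iterValue_succ, mass_iterValue_succ (n + 1)]
    exact (hmin _ _ _ (hsel _ c)).trans (payoff_mono U _ fun c' _ => ih c')

/-- A memoryless strategy that keeps the probability of termination in `U`, in any number of
steps, below the limit of the minimal probabilities. -/
theorem exists_memoryless (hsel : ∀ u c, Step I c (sel u c))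
    (hmin : ∀ u c ν, Step I c ν → payoff U u (sel u c).weights ≤ payoff U u ν.weights)
    (c : Conf A B S) : ∃ ν, Step I c ν ∧
      payoff U (fun c' => ⨆ n, (iterValue U sel n c').mass U) ν.weights ≤
        ⨆ n, (iterValue U sel n c).mass U := by
  have hbdd : ∀ c' : Conf A B S, BddAbove (Set.range fun n => (iterValue U sel n c').mass U) :=
    fun c' => ⟨1, by rintro _ ⟨n, rfl⟩; exact mass_iterValue_le_one n c'⟩
  by_contra! hcon
  -- Each payoff is a finite sum, so it commutes with the limit of the minimal values.
  have hlim : ∀ ν : Val1 (Outcome A B S), Filter.Tendsto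
      (fun n => payoff U (fun c' => (iterValue U sel n c').mass U) ν.weights) Filter.atTop
      (nhds (payoff U (fun c' => ⨆ n, (iterValue U sel n c').mass U) ν.weights)) := by
    intro ν
    simp only [payoff_apply]
    refine tendsto_finsetSum _ fun x _ => Filter.Tendsto.const_mul _ ?_
    rcases x with s | c'
    · exact tendsto_const_nhds
    · exact tendsto_atTop_ciSup (monotone_mass_iterValue hsel hmin c') (hbdd c')
  -- Finite branching enters here: one horizon `n` at which all steps exceed the limit value of `c`.
  -- The optimal step for this horizon cannot, because its payoff is the minimal value for `n + 1`
  -- steps.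
  have hev := ((finite_setOf_step I c).eventually_all (l := Filter.atTop)).2
    fun ν hν => (hlim ν).eventually (lt_mem_nhds (hcon ν hν))
  obtain ⟨n, hn⟩ := hev.exists
  refine absurd (hn _ (hsel (fun c' => (iterValue U sel n c').mass U) c)) (not_lt.2 ?_)
  rw [← mass_iterValue_succ]
  exact le_ciSup (hbdd c) (n + 1)

theorem exists_nonBlocking_mass_le (hsel : ∀ u c, Step I c (sel u c))
    (hmin : ∀ u c ν, Step I c ν → payoff U u (sel u c).weights ≤ payoff U u ν.weights)
    (c : Conf A B S) : ∃ σ : Scheduler I, NonBlocking σ c ∧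
      ∀ n h c' μ, BigStep σ n h c' μ → μ.mass U ≤ ⨆ n, (iterValue U sel n c').mass U := by
  choose g hg hgv using exists_memoryless (U := U) hsel hmin
  have hblock : ∀ n (h : History A B S) (c : Conf A B S),
      ∃ μ, BigStep (Scheduler.ofChoice (fun _ => g) fun _ => hg) n h c μ := by
    intro n
    induction n with
    | zero => exact fun h c => ⟨0, .zero h c⟩
    | succ n ih =>
      intro h c
      choose f hf using ih (h ++ [(c, g c)])
      exact ⟨_, BigStep.ofChoice hf⟩
  refine ⟨Scheduler.ofChoice (fun _ => g) fun _ => hg, fun n => hblock n [] c, ?_⟩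
  intro n h c' μ H
  induction H with
  | zero => simp [Val.mass_eq]
  | succ n h c w m hw hσ hm ih =>
    refine le_trans ?_ (hgv c)
    -- The evaluation may split `g c` into other available valuations. Only the barycentre of `w` is
    -- known, and by linearity the payoff depends on nothing else.
    have e : g c = w.sConvexComb := by simpa [Scheduler.ofChoice] using hσ
    rw [mass_bigStep_sum, e, payoff_sConvexComb]
    exact Finset.sum_le_sum fun ν hν => mul_le_mul_right (payoff_mono U _ fun c' hc' =>
      ih ν hν c' hc') _

end Strategies

/-- A maximum over a finite nonempty set is attained; it is chosen for all payoff functions `u` at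
once, as the backward induction changes `u` at each stage. -/
theorem exists_max_selector (I : Interp A B S) (U : Set S) :
    ∃ sel : (Conf A B S → ℝ≥0) → Conf A B S → Val1 (Outcome A B S), (∀ u c, Step I c (sel u c)) ∧
      ∀ u c ν, Step I c ν → payoff U u ν.weights ≤ payoff U u (sel u c).weights := by
  choose sel h1 h2 using fun (u : Conf A B S → ℝ≥0) (c : Conf A B S) =>
    Set.exists_max_image _ (fun ν : Val1 (Outcome A B S) => payoff U u ν.weights)
      (finite_setOf_step I c) (exists_step I c)
  exact ⟨sel, h1, h2⟩

theorem exists_min_selector (I : Interp A B S) (U : Set S) :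
    ∃ sel : (Conf A B S → ℝ≥0) → Conf A B S → Val1 (Outcome A B S), (∀ u c, Step I c (sel u c)) ∧
      ∀ u c ν, Step I c ν → payoff U u (sel u c).weights ≤ payoff U u ν.weights := by
  choose sel h1 h2 using fun (u : Conf A B S → ℝ≥0) (c : Conf A B S) =>
    Set.exists_min_image _ (fun ν : Val1 (Outcome A B S) => payoff U u ν.weights)
      (finite_setOf_step I c) (exists_step I c)
  exact ⟨sel, h1, h2⟩

/-! ### Exhaustive search for statistical termination -/

theorem dia_iff_exists_FSet (I : Interp A B S) (c : Conf A B S) (φ : PForm S) {ι : Type*}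
    (p : ι → ℝ≥0) (U : ι → Set S) (hφ : ∀ μ, φ.Sat μ ↔ ∃ i, p i < μ.mass (U i)) :
    (Form.dia φ).Sat I c ↔ ∃ n, 1 ≤ n ∧ ∃ μ ∈ FSet I n c, φ.Sat μ := by
  constructor
  · rintro ⟨σ, n, μ, H, hμ⟩
    obtain ⟨i, hi⟩ := (hφ μ).1 hμ
    obtain ⟨sel, hsel, hmax⟩ := exists_max_selector I (U i)
    refine ⟨n, ?_, _, iterValue_mem_FSet (U := U i) hsel n c, (hφ _).2
      ⟨i, hi.trans_le (mass_le_iterValue_of_bigStep hmax H)⟩⟩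
    -- Zero steps yield only `⊥`, whose mass `0` exceeds no threshold.
    rw [Nat.one_le_iff_ne_zero]
    rintro rfl
    cases H
    simp [Val.mass_eq] at hi
  · rintro ⟨n, -, μ, hF, hμ⟩
    obtain ⟨i, hi⟩ := (hφ μ).1 hμ
    obtain ⟨sel, hsel, hmax⟩ := exists_max_selector I (U i)
    obtain ⟨σ, hσ⟩ := exists_bigStep_iterValue (U := U i) hsel n c
    exact ⟨σ, n, _, hσ, (hφ _).2 ⟨i, hi.trans_le (mass_le_iterValue_of_mem_FSet hmax hF)⟩⟩

theorem box_iff_exists_FSet (I : Interp A B S) (c : Conf A B S) (φ : PForm S) {ι : Type*}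
    [Finite ι] (p : ι → ℝ≥0) (U : ι → Set S) (hφ : ∀ μ, φ.Sat μ ↔ ∀ i, p i < μ.mass (U i)) :
    (Form.box φ).Sat I c ↔ ∃ n, 1 ≤ n ∧ ∀ μ ∈ FSet I n c, φ.Sat μ := by
  choose sel hsel hmin using fun i => exists_min_selector I (U i)
  constructor
  · intro H
    have key : ∀ i, ∃ n, p i < (iterValue (U i) (sel i) n c).mass (U i) := by
      intro i
      by_contra! hcon
      obtain ⟨σ, hσ, hle⟩ := exists_nonBlocking_mass_le (U := U i) (hsel i) (hmin i) c
      obtain ⟨n, μ, hμ, hsat⟩ := H σ hσ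
      -- If conjunct `i` failed for the minimal values at every horizon, their supremum would be at
      -- most `p i`, and the memoryless scheduler would refute `□`.
      exact absurd ((hφ μ).1 hsat i) (not_lt.2 ((hle _ _ _ _ hμ).trans (ciSup_le hcon)))
    choose N hN using key
    obtain ⟨M, hM⟩ := Set.Finite.bddAbove (Set.finite_range N)
    -- `M` bounds the horizons of all conjuncts; adding `1` makes the horizon positive.
    refine ⟨M + 1, by omega, fun μ hμ => (hφ μ).2 fun i => ?_⟩
    refine (hN i).trans_le (le_trans ?_ (iterValue_le_mass_of_mem_FSet (hmin i) hμ))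
    exact monotone_mass_iterValue (hsel i) (hmin i) c
      ((hM ⟨i, rfl⟩).trans (Nat.le_succ M))
  · rintro ⟨n, -, H⟩ σ hσ
    obtain ⟨μ, hμ⟩ := hσ n
    refine ⟨n, μ, hμ, (hφ μ).2 fun i => ?_⟩
    exact ((hφ _).1 (H _ (iterValue_mem_FSet (U := U i) (hsel i) n c)) i).trans_le
      (iterValue_le_mass_of_bigStep (hmin i) hμ)

end Semantics

/-! ### Computable functions on lists and computable predicates -/

section ComputableLists

variable {α β γ σ : Type*} [Primcodable α] [Primcodable β] [Primcodable γ] [Primcodable σ]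

/-- The fold becomes a recursion on the number of entries read: after `n` rounds the accumulator is
the fold of the first `n` entries. -/
theorem Computable.list_foldl {f : α → List β} {g : α → σ} {h : α → σ × β → σ}
    (hf : Computable f) (hg : Computable g) (hh : Computable₂ h) :
    Computable fun a => (f a).foldl (fun s b => h a (s, b)) (g a) := by
  have hstep : Computable₂ fun (a : α) (x : ℕ × σ) =>
      (Option.casesOn ((f a)[x.1]?) x.2 fun b => h a (x.2, b) : σ) := by
    refine Computable.option_casesOn (Computable.list_getElem?.comp (hf.comp .fst)
      (Computable.fst.comp .snd)) (Computable.snd.comp .snd) ?_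
    exact hh.comp (Computable.fst.comp .fst)
      (((Computable.snd.comp .snd).comp .fst).pair .snd)
  refine (Computable.nat_rec (Computable.list_length.comp hf) hg hstep).of_eq fun a => ?_
  have key : ∀ n, (Nat.rec (g a) (fun y IH =>
      (Option.casesOn ((f a)[y]?) IH fun b => h a (IH, b) : σ)) n : σ) =
        ((f a).take n).foldl (fun s b => h a (s, b)) (g a) := by
    intro n
    induction n with
    | zero => simp
    | succ n ih =>
      rw [List.take_add_one, List.foldl_append, ← ih]
      dsimp only
      cases (f a)[n]? <;> simp
  exact (key _).trans (by rw [List.take_length])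

theorem Computable.list_foldr {f : α → List β} {g : α → σ} {h : α → β × σ → σ}
    (hf : Computable f) (hg : Computable g) (hh : Computable₂ h) :
    Computable fun a => (f a).foldr (fun b s => h a (b, s)) (g a) :=
  (Computable.list_foldl (Computable.list_reverse.comp hf) hg
    (h := fun a (x : σ × β) => h a (x.2, x.1))
    (hh.comp .fst ((Computable.snd.pair .fst).comp .snd))).of_eq
    fun a => by simp [List.foldl_reverse]

theorem Computable.list_map {f : α → List β} {g : α → β → σ} (hf : Computable f)
    (hg : Computable₂ g) : Computable fun a => (f a).map (g a) :=
  (Computable.list_foldr hf (.const []) (h := fun a (x : β × List σ) => g a x.1 :: x.2)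
    (Computable.list_cons.comp (hg.comp .fst (Computable.fst.comp .snd))
      (Computable.snd.comp .snd))).of_eq
    fun a => by induction f a <;> simp_all

theorem Computable.list_flatMap {f : α → List β} {g : α → β → List σ} (hf : Computable f)
    (hg : Computable₂ g) : Computable fun a => (f a).flatMap (g a) :=
  (Primrec.list_flatten.to_comp.comp (hf.list_map hg)).of_eq fun a => by
    rw [List.flatMap_def]

theorem Computable.list_any {f : α → List β} {g : α → β → Bool} (hf : Computable f)
    (hg : Computable₂ g) : Computable fun a => (f a).any (g a) :=
  (Computable.list_foldr hf (.const false) (h := fun a (x : β × Bool) => g a x.1 || x.2)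
    (Primrec.or.to_comp.comp (hg.comp .fst (Computable.fst.comp .snd))
      (Computable.snd.comp .snd))).of_eq
    fun a => by induction f a <;> simp_all

theorem Computable.list_all {f : α → List β} {g : α → β → Bool} (hf : Computable f)
    (hg : Computable₂ g) : Computable fun a => (f a).all (g a) :=
  (Computable.list_foldr hf (.const true) (h := fun a (x : β × Bool) => g a x.1 && x.2)
    (Primrec.and.to_comp.comp (hg.comp .fst (Computable.fst.comp .snd))
      (Computable.snd.comp .snd))).of_eq
    fun a => by induction f a <;> simp_all

/-- Finitely many computable functions are uniformly computable: tabulate all their values and read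
off the entry wanted. -/
theorem Computable.fin_uncurry {k : ℕ} {f : Fin k → α → σ} (hf : ∀ i, Computable (f i)) :
    Computable fun x : Fin k × α => f x.1 x.2 := by
  refine Computable.option_some_iff.1 ?_
  refine (Computable.list_getElem?.comp ((Computable.list_ofFn hf).comp .snd)
    (Primrec.fin_val.to_comp.comp .fst)).of_eq fun x => ?_
  simp

theorem ComputablePred.comp {p : β → Prop} (hp : ComputablePred p) {f : α → β}
    (hf : Computable f) : ComputablePred fun a => p (f a) := by
  obtain ⟨t, ht, rfl⟩ := ComputablePred.computable_iff.1 hp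
  exact ComputablePred.computable_iff.2 ⟨_, ht.comp hf, rfl⟩

theorem ComputablePred.and {p q : α → Prop} (hp : ComputablePred p) (hq : ComputablePred q) :
    ComputablePred fun a => p a ∧ q a := by
  obtain ⟨t, ht, rfl⟩ := ComputablePred.computable_iff.1 hp
  obtain ⟨u, hu, rfl⟩ := ComputablePred.computable_iff.1 hq
  exact ComputablePred.computable_iff.2 ⟨_, Primrec.and.to_comp.comp ht hu, by simp⟩

theorem ComputablePred.or {p q : α → Prop} (hp : ComputablePred p) (hq : ComputablePred q) :
    ComputablePred fun a => p a ∨ q a := by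
  obtain ⟨t, ht, rfl⟩ := ComputablePred.computable_iff.1 hp
  obtain ⟨u, hu, rfl⟩ := ComputablePred.computable_iff.1 hq
  exact ComputablePred.computable_iff.2 ⟨_, Primrec.or.to_comp.comp ht hu, by simp⟩

theorem ComputablePred.const (p : Prop) : ComputablePred fun _ : α => p := by
  classical exact (Computable.const (decide p)).computablePred

theorem ComputablePred.exists_fin {k : ℕ} {p : Fin k → α → Prop}
    (hp : ∀ i, ComputablePred (p i)) : ComputablePred fun a => ∃ i, p i a := by
  induction k with
  | zero => exact (ComputablePred.const False).of_eq fun a => by simp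
  | succ k ih => exact ((hp 0).or (ih fun i => hp i.succ)).of_eq fun a =>
      (Fin.exists_fin_succ (P := fun i => p i a)).symm

theorem ComputablePred.forall_fin {k : ℕ} {p : Fin k → α → Prop}
    (hp : ∀ i, ComputablePred (p i)) : ComputablePred fun a => ∀ i, p i a := by
  induction k with
  | zero => exact (ComputablePred.const True).of_eq fun a => by simp
  | succ k ih => exact ((hp 0).and (ih fun i => hp i.succ)).of_eq fun a =>
      (Fin.forall_fin_succ (P := fun i => p i a)).symm

theorem ComputablePred.exists_mem_list {p : β → Prop} (hp : ComputablePred p) {f : α → List β}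
    (hf : Computable f) : ComputablePred fun a => ∃ b ∈ f a, p b := by
  obtain ⟨t, ht, rfl⟩ := ComputablePred.computable_iff.1 hp
  exact ComputablePred.computable_iff.2
    ⟨_, hf.list_any (g := fun _ b => t b) (ht.comp .snd), by simp⟩

theorem ComputablePred.forall_mem_list {p : β → Prop} (hp : ComputablePred p) {f : α → List β}
    (hf : Computable f) : ComputablePred fun a => ∀ b ∈ f a, p b := by
  obtain ⟨t, ht, rfl⟩ := ComputablePred.computable_iff.1 hp
  exact ComputablePred.computable_iff.2
    ⟨_, hf.list_all (g := fun _ b => t b) (ht.comp .snd), by simp⟩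

/-- Unbounded search. -/
theorem ComputablePred.exists_nat_re {p : ℕ × α → Prop} (hp : ComputablePred p) :
    REPred fun a => ∃ n, p (n, a) := by
  obtain ⟨t, ht, rfl⟩ := ComputablePred.computable_iff.1 hp
  have h : Partrec fun a : α => Nat.rfind fun n => Part.some (t (n, a)) :=
    Partrec.rfind (p := fun (a : α) (n : ℕ) => Part.some (t (n, a)))
      (ht.comp (Computable.snd.pair .fst)).partrec
  refine h.dom_re.of_eq fun a => ?_
  refine Nat.rfind_dom.trans ?_
  simp

end ComputableLists

/-! ### Arithmetic of fractions -/

/-- The value `a / (b + 1)` of the pair `(a, b)`. -/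
noncomputable def fracVal (q : ℕ × ℕ) : ℝ≥0 := (q.1 : ℝ≥0) / ((q.2 : ℝ≥0) + 1)

/-- Denominators are stored minus one, and `(b + 1) * (d + 1) - 1 = b * d + b + d`. -/
def fracMul (q r : ℕ × ℕ) : ℕ × ℕ := (q.1 * r.1, q.2 * r.2 + q.2 + r.2)

def fracAdd (q r : ℕ × ℕ) : ℕ × ℕ :=
  (q.1 * (r.2 + 1) + r.1 * (q.2 + 1), q.2 * r.2 + q.2 + r.2)

theorem fracVal_mul (q r : ℕ × ℕ) : fracVal (fracMul q r) = fracVal q * fracVal r := by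
  simp only [fracVal, fracMul]
  push_cast
  rw [div_mul_div_comm]
  congr 1
  ring

theorem fracVal_add (q r : ℕ × ℕ) : fracVal (fracAdd q r) = fracVal q + fracVal r := by
  simp only [fracVal, fracAdd]
  push_cast
  rw [div_add_div _ _ (by positivity) (by positivity)]
  congr 1
  · ring
  · ring

@[simp]
theorem fracVal_zero : fracVal (0, 0) = 0 := by simp [fracVal]

@[simp]
theorem fracVal_one : fracVal (1, 0) = 1 := by simp [fracVal]

theorem primrec_fracMul : Primrec₂ fracMul := by
  have h1 : Primrec fun x : (ℕ × ℕ) × (ℕ × ℕ) => x.1.1 := Primrec.fst.comp .fst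
  have h2 : Primrec fun x : (ℕ × ℕ) × (ℕ × ℕ) => x.1.2 := Primrec.snd.comp .fst
  have h3 : Primrec fun x : (ℕ × ℕ) × (ℕ × ℕ) => x.2.1 := Primrec.fst.comp .snd
  have h4 : Primrec fun x : (ℕ × ℕ) × (ℕ × ℕ) => x.2.2 := Primrec.snd.comp .snd
  exact (Primrec.nat_mul.comp h1 h3).pair
    (Primrec.nat_add.comp (Primrec.nat_add.comp (Primrec.nat_mul.comp h2 h4) h2) h4)

theorem primrec_fracAdd : Primrec₂ fracAdd := by
  have h1 : Primrec fun x : (ℕ × ℕ) × (ℕ × ℕ) => x.1.1 := Primrec.fst.comp .fst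
  have h2 : Primrec fun x : (ℕ × ℕ) × (ℕ × ℕ) => x.1.2 := Primrec.snd.comp .fst
  have h3 : Primrec fun x : (ℕ × ℕ) × (ℕ × ℕ) => x.2.1 := Primrec.fst.comp .snd
  have h4 : Primrec fun x : (ℕ × ℕ) × (ℕ × ℕ) => x.2.2 := Primrec.snd.comp .snd
  exact (Primrec.nat_add.comp (Primrec.nat_mul.comp h1 (Primrec.succ.comp h4))
      (Primrec.nat_mul.comp h3 (Primrec.succ.comp h2))).pair
    (Primrec.nat_add.comp (Primrec.nat_add.comp (Primrec.nat_mul.comp h2 h4) h2) h4)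

/-- The sum of a list of fractions. -/
def fracSum (l : List (ℕ × ℕ)) : ℕ × ℕ := l.foldr fracAdd (0, 0)

theorem fracVal_fracSum (l : List (ℕ × ℕ)) : fracVal (fracSum l) = (l.map fracVal).sum := by
  induction l with
  | nil => simp [fracSum]
  | cons q l ih => rw [fracSum, List.foldr_cons, ← fracSum, fracVal_add, ih]; simp

theorem primrec_fracSum : Primrec fracSum :=
  (Primrec.list_foldr .id (.const (0, 0)) (primrec_fracAdd.comp (Primrec.fst.comp .snd)
    (Primrec.snd.comp .snd)).to₂).of_eq fun _ => rfl

theorem lt_fracVal_iff (p : ℚ≥0) (q : ℕ × ℕ) :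
    (p : ℝ≥0) < fracVal q ↔ p.num * (q.2 + 1) < q.1 * p.den := by
  have e : (p : ℝ≥0) = (p.num : ℝ≥0) / (p.den : ℝ≥0) := by
    conv_lhs => rw [← NNRat.num_div_den p]
    push_cast
    rfl
  rw [e, fracVal, div_lt_div_iff₀ (by exact_mod_cast p.den_pos) (by positivity)]
  norm_cast

theorem primrecPred_lt_fracVal (p : ℚ≥0) : PrimrecPred fun q : ℕ × ℕ => (p : ℝ≥0) < fracVal q :=
  (Primrec.nat_lt.comp (Primrec.nat_mul.comp (.const p.num) (Primrec.succ.comp .snd))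
    (Primrec.nat_mul.comp .fst (.const p.den))).of_eq fun q => (lt_fracVal_iff p q).symm

/-! ### Linear combinations with rational coefficients -/

namespace RatComb

variable {X Y : Type*}

@[simp]
theorem val_nil : val ([] : RatComb X) = 0 := rfl

theorem val_cons (e : X × ℕ × ℕ) (l : RatComb X) :
    val (e :: l) = Finsupp.single e.1 (fracVal e.2) + val l := rfl

@[simp]
theorem val_append (l m : RatComb X) : val (l ++ m) = val l + val m := by
  simp [val]

/-- Renaming of the points. -/
def mapKey (f : X → Y) (l : RatComb X) : RatComb Y := l.map fun e => (f e.1, e.2)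

/-- Multiplication by a scalar. -/
def scale (q : ℕ × ℕ) (l : RatComb X) : RatComb X := l.map fun e => (e.1, fracMul q e.2)

theorem val_mapKey (f : X → Y) (l : RatComb X) : val (mapKey f l) = (val l).mapDomain f := by
  induction l with
  | nil => simp [mapKey]
  | cons e l ih =>
    rw [mapKey, List.map_cons, ← mapKey, val_cons, val_cons, ih, Finsupp.mapDomain_add,
      Finsupp.mapDomain_single]

theorem val_scale (q : ℕ × ℕ) (l : RatComb X) : val (scale q l) = fracVal q • val l := by
  induction l with
  | nil => simp [scale]
  | cons e l ih =>
    rw [scale, List.map_cons, ← scale, val_cons, val_cons, ih, smul_add, Finsupp.smul_single,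
      fracVal_mul, smul_eq_mul]

/-- The total coefficient of `x`. -/
def coeff [DecidableEq X] (l : RatComb X) (x : X) : ℕ × ℕ :=
  fracSum ((l.filter fun e => e.1 = x).map Prod.snd)

/-- All entries but those at `x`. -/
def erase [DecidableEq X] (l : RatComb X) (x : X) : RatComb X :=
  l.filter fun e => ¬e.1 = x

/-- Merging of entries at the same point. -/
def merge [DecidableEq X] (l : RatComb X) : RatComb X :=
  l.foldr (fun e m => (e.1, fracAdd e.2 (coeff m e.1)) :: erase m e.1) []

theorem val_coeff_erase [DecidableEq X] (l : RatComb X) (x : X) :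
    Finsupp.single x (fracVal (coeff l x)) + val (erase l x) = val l := by
  induction l with
  | nil => simp [coeff, erase, fracSum]
  | cons e l ih =>
    rw [val_cons, ← ih]
    by_cases h : e.1 = x
    · subst h
      simp [coeff, erase, fracVal_fracSum, Finsupp.single_add, add_assoc]
    · simp [coeff, erase, fracVal_fracSum, h, val_cons, add_left_comm]

theorem val_merge [DecidableEq X] (l : RatComb X) : val (merge l) = val l := by
  induction l with
  | nil => rfl
  | cons e l ih =>
    rw [merge, List.foldr_cons, ← merge, val_cons, val_cons, ← ih, ← val_coeff_erase (merge l) e.1]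
    simp only [fracVal_add, Finsupp.single_add, add_assoc, val_coeff_erase]

theorem nodup_merge [DecidableEq X] (l : RatComb X) : ((merge l).map Prod.fst).Nodup := by
  induction l with
  | nil => simp [merge]
  | cons e l ih =>
    rw [merge, List.foldr_cons, ← merge, List.map_cons, List.nodup_cons]
    refine ⟨?_, (List.filter_sublist.map _).nodup ih⟩
    simp [erase]

theorem mass_val (l : RatComb X) (U : Set X) [DecidablePred (· ∈ U)] :
    (val l).mass U = fracVal (fracSum ((l.filter fun e => e.1 ∈ U).map Prod.snd)) := by
  rw [Val.mass_eq, fracVal_fracSum]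
  induction l with
  | nil => simp
  | cons e l ih =>
    rw [val_cons, map_add, ih, massLinear, Finsupp.linearCombination_single]
    by_cases h : e.1 ∈ U <;> simp [h]

section Primrec

variable [Primcodable X] [Primcodable Y]

theorem computable_mapKey {α : Type*} [Primcodable α] {f : α → X → Y} {g : α → RatComb X}
    (hf : Computable₂ f) (hg : Computable g) : Computable fun a => mapKey (f a) (g a) :=
  hg.list_map (g := fun a (e : X × ℕ × ℕ) => (f a e.1, e.2))
    ((hf.comp .fst (Computable.fst.comp .snd)).pair (Computable.snd.comp .snd))

theorem primrec_scale : Primrec₂ (scale : ℕ × ℕ → RatComb X → RatComb X) :=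
  Primrec.list_map .snd (((Primrec.fst.comp .snd).pair (primrec_fracMul.comp
    (Primrec.fst.comp .fst) (Primrec.snd.comp .snd))).to₂)

variable [DecidableEq X]

theorem primrec_coeff : Primrec₂ (coeff : RatComb X → X → ℕ × ℕ) := by
  have h : PrimrecRel fun (e : X × ℕ × ℕ) (x : X) => e.1 = x :=
    Primrec.eq.comp (Primrec.fst.comp .fst) .snd
  exact primrec_fracSum.comp (Primrec.list_map h.listFilter (Primrec.snd.comp .snd).to₂)

theorem primrec_erase : Primrec₂ (erase : RatComb X → X → RatComb X) := by
  have h : PrimrecRel fun (e : X × ℕ × ℕ) (x : X) => e.1 = x :=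
    Primrec.eq.comp (Primrec.fst.comp .fst) .snd
  exact h.not.listFilter

theorem primrec_merge : Primrec (merge : RatComb X → RatComb X) := by
  have h1 : Primrec fun x : RatComb X × ((X × ℕ × ℕ) × RatComb X) => x.2.1.1 :=
    Primrec.fst.comp (Primrec.fst.comp .snd)
  have h2 : Primrec fun x : RatComb X × ((X × ℕ × ℕ) × RatComb X) => x.2.2 :=
    Primrec.snd.comp .snd
  refine Primrec.list_foldr .id (.const []) (h := fun _ (x : (X × ℕ × ℕ) × RatComb X) =>
    (x.1.1, fracAdd x.1.2 (coeff x.2 x.1.1)) :: erase x.2 x.1.1) ?_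
  exact Primrec.list_cons.comp (h1.pair (primrec_fracAdd.comp
    (Primrec.snd.comp (Primrec.fst.comp .snd)) (primrec_coeff.comp h2 h1)))
    (primrec_erase.comp h2 h1)

end Primrec

theorem computablePred_lt_mass [Primcodable X] (p : ℚ≥0) {U : Set X}
    (hU : ComputablePred fun x => x ∈ U) :
    ComputablePred fun l : RatComb X => (p : ℝ≥0) < (val l).mass U := by
  obtain ⟨hdec, hU⟩ := hU
  -- Membership in `U` is merely computable, not primitive recursive, so the filter is written as a
  -- `flatMap`, for which `Computable.list_flatMap` is available.
  have h : Computable fun l : RatComb X => fracSum (l.flatMap fun e : X × ℕ × ℕ =>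
      bif decide (e.1 ∈ U) then [e.2] else []) :=
    primrec_fracSum.to_comp.comp (Computable.id.list_flatMap
      (g := fun (_ : RatComb X) (e : X × ℕ × ℕ) => bif decide (e.1 ∈ U) then [e.2] else [])
      (Computable.cond (hU.comp (Computable.fst.comp .snd))
        (Computable.list_cons.comp (Computable.snd.comp .snd) (.const [])) (.const [])))
  refine ((primrecPred_lt_fracVal p).computablePred.comp h).of_eq fun l => ?_
  rw [mass_val]
  have e : (l.flatMap fun e => bif decide (e.1 ∈ U) then [e.2] else []) =
      (l.filter fun e => e.1 ∈ U).map Prod.snd := by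
    induction l with
    | nil => rfl
    | cons e l ih =>
      rw [List.flatMap_cons, ih]
      by_cases h : e.1 ∈ U <;> simp [h]
  rw [e]

end RatComb

/-! ### The possible steps as lists -/

section Steps

variable {A B S : Type*}

/-- The fraction `p`. -/
def RatProb.frac (p : RatProb) : ℕ × ℕ := ((RatProb.equivFrac p).1.1, (RatProb.equivFrac p).1.2 - 1)

/-- The fraction `1 - p`. -/
def RatProb.cofrac (p : RatProb) : ℕ × ℕ :=
  ((RatProb.equivFrac p).1.2 - (RatProb.equivFrac p).1.1, (RatProb.equivFrac p).1.2 - 1)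

theorem RatProb.fracVal_frac (p : RatProb) : fracVal p.frac = (p.1 : ℝ≥0) := by
  change ((p.1.num : ℕ) : ℝ≥0) / (((p.1.den - 1 : ℕ) : ℝ≥0) + 1) = _
  have h : ((p.1.den - 1 : ℕ) : ℝ≥0) + 1 = (p.1.den : ℝ≥0) := by
    exact_mod_cast Nat.sub_add_cancel p.1.den_pos
  rw [h]
  conv_rhs => rw [← NNRat.num_div_den p.1]
  push_cast
  rfl

theorem RatProb.fracVal_cofrac (p : RatProb) : fracVal p.cofrac = 1 - (p.1 : ℝ≥0) := by
  refine eq_tsub_of_add_eq ?_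
  rw [← p.fracVal_frac]
  have h : (p.1.den - 1 : ℕ) + 1 = p.1.den := Nat.sub_add_cancel p.1.den_pos
  have hle : p.1.num ≤ p.1.den := (RatProb.equivFrac p).2.2.1
  change ((p.1.den - p.1.num : ℕ) : ℝ≥0) / (((p.1.den - 1 : ℕ) : ℝ≥0) + 1) +
    ((p.1.num : ℕ) : ℝ≥0) / (((p.1.den - 1 : ℕ) : ℝ≥0) + 1) = 1
  rw [← add_div, div_eq_one_iff_eq (by positivity)]
  norm_cast
  omega

theorem RatProb.primrec_frac : Primrec RatProb.frac := by
  have h : Primrec fun p => (RatProb.equivFrac p).1 :=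
    @Primrec.subtype_val_iff _ _ _ _ _ _ isRedFrac_primrec _ |>.2
      (@Primrec.of_equiv _ (Primcodable.subtype isRedFrac_primrec) _ RatProb.equivFrac)
  exact (Primrec.fst.comp h).pair (Primrec.pred.comp (Primrec.snd.comp h))

theorem RatProb.primrec_cofrac : Primrec RatProb.cofrac := by
  have h : Primrec fun p => (RatProb.equivFrac p).1 :=
    @Primrec.subtype_val_iff _ _ _ _ _ _ isRedFrac_primrec _ |>.2
      (@Primrec.of_equiv _ (Primcodable.subtype isRedFrac_primrec) _ RatProb.equivFrac)
  exact (Primrec.nat_sub.comp (Primrec.snd.comp h) (Primrec.fst.comp h)).pair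
    (Primrec.pred.comp (Primrec.snd.comp h))

/-- Resuming `Q` after termination, and continuing by `k` otherwise. -/
def resume (Q : Prog A B) (k : Prog A B → Prog A B) : Outcome A B S → Outcome A B S :=
  Sum.elim (fun t => .inr (Q, t)) (fun c => .inr (k c.1, c.2))

/-- All combinations of an element of `L` with weight `p` and an element of `M` with weight
`1 - p`. -/
def mixLists {X : Type*} (p : RatProb) (L M : List (RatComb X)) : List (RatComb X) :=
  L.flatMap fun l => M.map fun m => RatComb.scale p.frac l ++ RatComb.scale p.cofrac m

/-- The valuations available at a configuration, given rational presentations `g` of the values of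
the atomic programs. -/
def stepsList (g : A → S → RatComb S) (t : B → S → Bool) :
    Prog A B → S → List (RatComb (Outcome A B S))
  | .skip, s => [[(.inl s, 1, 0)]]
  | .atom a, s => [(g a s).mapKey .inl]
  | .seq P Q, s => (stepsList g t P s).map (RatComb.mapKey (resume Q fun P' => .seq P' Q))
  | .par P Q, s => (stepsList g t P s).map (RatComb.mapKey (resume Q fun P' => .par P' Q)) ++
      (stepsList g t Q s).map (RatComb.mapKey (resume P fun Q' => .par P Q'))
  | .prob p P Q, s => mixLists p (stepsList g t P s) (stepsList g t Q s)
  | .choice P Q, s => stepsList g t P s ++ stepsList g t Q s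
  | .ite b P Q, s => [[(.inr (bif t b s then P else Q, s), 1, 0)]]
  | .loop b P, s => [[(bif t b s then .inr (.seq P (.loop b P), s) else .inl s, 1, 0)]]

theorem RatComb.val_singleton_one {X : Type*} (x : X) :
    RatComb.val [(x, 1, 0)] = Finsupp.single x 1 := by
  simp [RatComb.val_cons]

theorem exists_mem_stepsList_of_step {I : Interp A B S} {g : A → S → RatComb S}
    (hg : ∀ a s, (g a s).val = (I.atom a s).weights) {c : Conf A B S}
    {ν : Val1 (Outcome A B S)} (h : Step I c ν) :
    ∃ l ∈ stepsList g I.cond c.1 c.2, l.val = ν.weights := by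
  induction h with
  | atom a s => exact ⟨_, List.mem_singleton_self _, by simp [RatComb.val_mapKey, hg]⟩
  | skip s => exact ⟨_, List.mem_singleton_self _, by simp [RatComb.val_singleton_one]⟩
  | seq h ih =>
    obtain ⟨l, hl, e⟩ := ih
    exact ⟨_, List.mem_map_of_mem hl, by rw [RatComb.val_mapKey, e]; rfl⟩
  | parLeft h ih =>
    obtain ⟨l, hl, e⟩ := ih
    exact ⟨_, List.mem_append_left _ (List.mem_map_of_mem hl), by
      rw [RatComb.val_mapKey, e]; rfl⟩
  | parRight h ih =>
    obtain ⟨l, hl, e⟩ := ih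
    exact ⟨_, List.mem_append_right _ (List.mem_map_of_mem hl), by
      rw [RatComb.val_mapKey, e]; rfl⟩
  | prob h1 h2 ih1 ih2 =>
    obtain ⟨l, hl, e⟩ := ih1
    obtain ⟨m, hm, e'⟩ := ih2
    exact ⟨_, List.mem_flatMap.2 ⟨l, hl, List.mem_map_of_mem hm⟩, by
      simp [RatComb.val_scale, e, e', RatProb.fracVal_frac, RatProb.fracVal_cofrac]⟩
  | choiceLeft h ih =>
    obtain ⟨l, hl, e⟩ := ih
    exact ⟨l, List.mem_append_left _ hl, e⟩
  | choiceRight h ih =>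
    obtain ⟨l, hl, e⟩ := ih
    exact ⟨l, List.mem_append_right _ hl, e⟩
  | iteTrue h =>
    exact ⟨_, List.mem_singleton_self _, by simp [RatComb.val_singleton_one, h]⟩
  | iteFalse h =>
    exact ⟨_, List.mem_singleton_self _, by simp [RatComb.val_singleton_one, h]⟩
  | loopTrue h =>
    exact ⟨_, List.mem_singleton_self _, by simp [RatComb.val_singleton_one, h]⟩
  | loopFalse h =>
    exact ⟨_, List.mem_singleton_self _, by simp [RatComb.val_singleton_one, h]⟩

/-- The lists carry no proof of total mass `1`; applying the rule that matches each clause recovers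
the normalised valuation. -/
theorem exists_step_of_mem_stepsList {I : Interp A B S} {g : A → S → RatComb S}
    (hg : ∀ a s, (g a s).val = (I.atom a s).weights) {P : Prog A B} {s : S}
    {l : RatComb (Outcome A B S)} (h : l ∈ stepsList g I.cond P s) :
    ∃ ν, Step I (P, s) ν ∧ l.val = ν.weights := by
  induction P generalizing s l with
  | skip =>
    obtain rfl := List.mem_singleton.1 h
    exact ⟨_, .skip s, by simp [RatComb.val_singleton_one]⟩
  | atom a =>
    obtain rfl := List.mem_singleton.1 h
    exact ⟨_, .atom a s, by simp [RatComb.val_mapKey, hg]⟩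
  | seq P Q hP hQ =>
    obtain ⟨l, hl, rfl⟩ := List.mem_map.1 h
    obtain ⟨ν, hν, e⟩ := hP hl
    exact ⟨_, .seq hν, by rw [RatComb.val_mapKey, e]; rfl⟩
  | par P Q hP hQ =>
    rcases List.mem_append.1 h with h | h
    · obtain ⟨l, hl, rfl⟩ := List.mem_map.1 h
      obtain ⟨ν, hν, e⟩ := hP hl
      exact ⟨_, .parLeft hν, by rw [RatComb.val_mapKey, e]; rfl⟩
    · obtain ⟨l, hl, rfl⟩ := List.mem_map.1 h
      obtain ⟨ν, hν, e⟩ := hQ hl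
      exact ⟨_, .parRight hν, by rw [RatComb.val_mapKey, e]; rfl⟩
  | prob p P Q hP hQ =>
    obtain ⟨l, hl, h⟩ := List.mem_flatMap.1 h
    obtain ⟨m, hm, rfl⟩ := List.mem_map.1 h
    obtain ⟨μ, hμ, e⟩ := hP hl
    obtain ⟨ν, hν, e'⟩ := hQ hm
    exact ⟨_, .prob hμ hν, by
      simp [RatComb.val_scale, e, e', RatProb.fracVal_frac, RatProb.fracVal_cofrac]⟩
  | choice P Q hP hQ =>
    rcases List.mem_append.1 h with h | h
    · obtain ⟨ν, hν, e⟩ := hP h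
      exact ⟨_, .choiceLeft hν, e⟩
    · obtain ⟨ν, hν, e⟩ := hQ h
      exact ⟨_, .choiceRight hν, e⟩
  | ite b P Q hP hQ =>
    obtain rfl := List.mem_singleton.1 h
    cases hb : I.cond b s
    · exact ⟨_, .iteFalse hb, by simp [RatComb.val_singleton_one]⟩
    · exact ⟨_, .iteTrue hb, by simp [RatComb.val_singleton_one]⟩
  | loop b P hP =>
    obtain rfl := List.mem_singleton.1 h
    cases hb : I.cond b s
    · exact ⟨_, .loopFalse hb, by simp [RatComb.val_singleton_one]⟩
    · exact ⟨_, .loopTrue hb, by simp [RatComb.val_singleton_one]⟩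

/-! ### Computing the possible steps -/

section Primrec

variable [Primcodable A] [Primcodable B] [Primcodable S] {α : Type*} [Primcodable α]

/-- Programs are coded through their words, so building a program amounts to concatenating lists. -/
theorem Prog.primrec_iff {f : α → Prog A B} : Primrec f ↔ Primrec fun a => (f a).word := by
  have hp : PrimrecPred fun l : List (Letter A B) => Prog.height l = some 1 :=
    Primrec.eq.comp Prog.height_primrec (Primrec.const (some 1))
  let := Primcodable.subtype hp
  exact (Primrec.of_equiv_iff Prog.equivWord).symm.trans Primrec.subtype_val_iff.symm

theorem Prog.primrec_word : Primrec (Prog.word : Prog A B → List (Letter A B)) :=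
  Prog.primrec_iff.1 .id

theorem Prog.primrec_atom : Primrec (Prog.atom : A → Prog A B) :=
  Prog.primrec_iff.2 (Primrec.list_cons.comp .sumInl (.const []))

/-- Programs formed by a letter and two arguments. -/
theorem Prog.primrec_cons_word_append {f : α → Letter A B} {P Q : α → Prog A B} (hf : Primrec f)
    (hP : Primrec P) (hQ : Primrec Q) :
    Primrec fun a => f a :: ((P a).word ++ (Q a).word) :=
  Primrec.list_cons.comp hf (Primrec.list_append.comp (Prog.primrec_word.comp hP)
    (Prog.primrec_word.comp hQ))

theorem Prog.primrec_seq : Primrec₂ (Prog.seq : Prog A B → Prog A B → Prog A B) :=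
  Prog.primrec_iff.2 (Prog.primrec_cons_word_append (.const _) .fst .snd)

theorem Prog.primrec_par : Primrec₂ (Prog.par : Prog A B → Prog A B → Prog A B) :=
  Prog.primrec_iff.2 (Prog.primrec_cons_word_append (.const _) .fst .snd)

theorem Prog.primrec_choice : Primrec₂ (Prog.choice : Prog A B → Prog A B → Prog A B) :=
  Prog.primrec_iff.2 (Prog.primrec_cons_word_append (.const _) .fst .snd)

theorem Prog.primrec_prob :
    Primrec fun x : RatProb × Prog A B × Prog A B => Prog.prob x.1 x.2.1 x.2.2 :=
  Prog.primrec_iff.2 (Prog.primrec_cons_word_append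
    (Primrec.sumInr.comp (Primrec.sumInr.comp (Primrec.sumInl.comp .fst)))
    (Primrec.fst.comp .snd) (Primrec.snd.comp .snd))

theorem Prog.primrec_ite :
    Primrec fun x : B × Prog A B × Prog A B => Prog.ite x.1 x.2.1 x.2.2 :=
  Prog.primrec_iff.2 (Prog.primrec_cons_word_append
    (Primrec.sumInr.comp (Primrec.sumInl.comp (Primrec.fst.pair (.const true))))
    (Primrec.fst.comp .snd) (Primrec.snd.comp .snd))

theorem Prog.primrec_loop : Primrec₂ (Prog.loop : B → Prog A B → Prog A B) :=
  Prog.primrec_iff.2 (Primrec.list_cons.comp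
    (Primrec.sumInr.comp (Primrec.sumInl.comp (Primrec.fst.pair (.const false))))
    (Prog.primrec_word.comp .snd))

theorem computable_resume (k : Prog A B → Prog A B → Prog A B) (hk : Primrec₂ k) :
    Computable fun x : (Prog A B × Prog A B) × Outcome A B S =>
      resume x.1.1 (fun P' => k P' x.1.2) x.2 := by
  refine (Computable.sumCasesOn (f := fun x : (Prog A B × Prog A B) × Outcome A B S => x.2)
    (g := fun x t => (.inr (x.1.1, t) : Outcome A B S))
    (h := fun x c => (.inr (k c.1 x.1.2, c.2) : Outcome A B S)) .snd ?_ ?_).of_eq fun x => by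
      rcases x with ⟨_, _ | _⟩ <;> rfl
  · exact Computable.sumInr.comp
      ((Computable.fst.comp (Computable.fst.comp .fst)).pair .snd)
  · exact Computable.sumInr.comp ((hk.to_comp.comp (Computable.fst.comp .snd)
      (Computable.snd.comp (Computable.fst.comp .fst))).pair (Computable.snd.comp .snd))

theorem computable_map_resume {k : Prog A B → Prog A B → Prog A B} (hk : Primrec₂ k)
    {P Q : α → Prog A B} {L : α → List (RatComb (Outcome A B S))} (hP : Computable P)
    (hQ : Computable Q) (hL : Computable L) :
    Computable fun a => (L a).map (RatComb.mapKey (resume (P a) fun P' => k P' (Q a))) :=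
  hL.list_map (g := fun a l => RatComb.mapKey (resume (P a) fun P' => k P' (Q a)) l)
    (RatComb.computable_mapKey
      (f := fun (x : α × RatComb (Outcome A B S)) => resume (P x.1) fun P' => k P' (Q x.1))
      ((computable_resume k hk).comp
        (((hP.comp (Computable.fst.comp .fst)).pair (hQ.comp (Computable.fst.comp .fst))).pair
          .snd)) .snd)

theorem computable_mixLists {X : Type*} [Primcodable X] {p : α → RatProb}
    {L M : α → List (RatComb X)} (hp : Computable p) (hL : Computable L) (hM : Computable M) :
    Computable fun a => mixLists (p a) (L a) (M a) := by
  refine hL.list_flatMap (g := fun a l => (M a).map fun m =>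
    RatComb.scale (p a).frac l ++ RatComb.scale (p a).cofrac m) ?_
  refine (hM.comp .fst).list_map (g := fun (x : α × RatComb X) m =>
    RatComb.scale (p x.1).frac x.2 ++ RatComb.scale (p x.1).cofrac m) ?_
  have hp' : Computable fun x : (α × RatComb X) × RatComb X => p x.1.1 :=
    hp.comp (Computable.fst.comp .fst)
  exact Computable.list_append.comp
    (RatComb.primrec_scale.to_comp.comp (RatProb.primrec_frac.to_comp.comp hp')
      (Computable.snd.comp .fst))
    (RatComb.primrec_scale.to_comp.comp (RatProb.primrec_cofrac.to_comp.comp hp') .snd)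

end Primrec

/-- The program with the letter `x` at its root and the arguments `P` and `Q`, as far as they are
needed, together with its steps, given `P` and `Q` with their steps. -/
def rootSteps (g : A → S → RatComb S) (t : B → S → Bool) (s : S)
    (P Q : Prog A B × List (RatComb (Outcome A B S))) :
    Letter A B → Prog A B × List (RatComb (Outcome A B S))
  | .inl a => (.atom a, [(g a s).mapKey .inl])
  | .inr (.inl x) => bif x.2
      then (.ite x.1 P.1 Q.1, [[(.inr (bif t x.1 s then P.1 else Q.1, s), 1, 0)]])
      else (.loop x.1 P.1,
        [[(bif t x.1 s then .inr (.seq P.1 (.loop x.1 P.1), s) else .inl s, 1, 0)]])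
  | .inr (.inr (.inl p)) => (.prob p P.1 Q.1, mixLists p P.2 Q.2)
  | .inr (.inr (.inr i)) =>
      if i = 0 then (.skip, [[(.inl s, 1, 0)]])
      else if i = 1 then
        (.seq P.1 Q.1, P.2.map (RatComb.mapKey (resume Q.1 fun P' => .seq P' Q.1)))
      else if i = 2 then
        (.par P.1 Q.1, P.2.map (RatComb.mapKey (resume Q.1 fun P' => .par P' Q.1)) ++
          Q.2.map (RatComb.mapKey (resume P.1 fun Q' => .par P.1 Q')))
      else (.choice P.1 Q.1, P.2 ++ Q.2)

/-- Reading a letter, from the right, with the given stack of programs and of their steps. -/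
def pushSteps (g : A → S → RatComb S) (t : B → S → Bool) (s : S) (x : Letter A B)
    (st : List (Prog A B × List (RatComb (Outcome A B S)))) :
    List (Prog A B × List (RatComb (Outcome A B S))) :=
  rootSteps g t s (st.head?.getD (.skip, [])) (st.tail.head?.getD (.skip, [])) x ::
    st.drop (Prog.arity x)

/-- This replaces structural recursion on programs by a fold over a list. The subprograms travel
with their steps because the rules for `;` and `∥` mention them. On the word of a program every
argument needed is on the stack, so the default entries of `pushSteps` do not affect the result. -/
theorem foldr_pushSteps_word (g : A → S → RatComb S) (t : B → S → Bool) (s : S) (P : Prog A B)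
    (st : List (Prog A B × List (RatComb (Outcome A B S)))) :
    P.word.foldr (pushSteps g t s) st = (P, stepsList g t P s) :: st := by
  induction P generalizing st with
  | skip => rfl
  | atom a => rfl
  | seq P Q hP hQ | par P Q hP hQ | prob p P Q hP hQ | choice P Q hP hQ | ite b P Q hP hQ =>
    rw [Prog.word, List.foldr_cons, List.foldr_append, hQ, hP]
    rfl
  | loop b P hP =>
    rw [Prog.word, List.foldr_cons, hP]
    rfl

section Primrec

variable [Primcodable A] [Primcodable B] [Primcodable S] {α : Type*} [Primcodable α]

theorem Prog.primrec_arity : Primrec (Prog.arity : Letter A B → ℕ) := by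
  have h : Primrec fun x : Letter A B => Sum.casesOn (motive := fun _ => ℕ) x (fun _ => 0)
      fun u => Sum.casesOn (motive := fun _ => ℕ) u (fun x => bif x.2 then 2 else 1)
        fun v => Sum.casesOn (motive := fun _ => ℕ) v (fun _ => 2)
          fun i => if i = 0 then 0 else 2 := by
    refine Primrec.sumCasesOn .id (Primrec.const 0).to₂ ?_
    refine Primrec.sumCasesOn .snd
      (Primrec.cond (Primrec.snd.comp .snd) (.const 2) (.const 1)).to₂ ?_
    refine Primrec.sumCasesOn .snd (Primrec.const 2).to₂ ?_
    exact ((Primrec.dom_finite fun i : Fin 4 => if i = 0 then 0 else 2).comp .snd).to₂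
  refine h.of_eq fun x => ?_
  rcases x with a | x | p | i <;> rfl

theorem Computable.ite_eq {σ X : Type*} [Primcodable σ] [Primcodable X] [DecidableEq X]
    {f : α → X} {x : X} {u v : α → σ} (hf : Computable f) (hu : Computable u)
    (hv : Computable v) : Computable fun a => if f a = x then u a else v a := by
  have h : ComputablePred fun y : X => y = x :=
    (Primrec.eq.comp .id (.const x)).computablePred
  exact (Computable.cond ((h.comp hf).decide) hu hv).of_eq fun a => by
    by_cases h : f a = x <;> simp [h]

theorem computable_singleton_one {X : Type*} [Primcodable X] {f : α → X} (hf : Computable f) :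
    Computable fun a => ([[(f a, 1, 0)]] : List (RatComb X)) :=
  Computable.list_cons.comp (Computable.list_cons.comp (hf.pair (.const (1, 0))) (.const []))
    (.const [])

theorem computable_rootSteps {g : A → S → RatComb S} {t : B → S → Bool}
    (hg : Computable fun x : A × S => g x.1 x.2) (ht : Computable fun x : B × S => t x.1 x.2)
    {s : α → S} {P Q : α → Prog A B × List (RatComb (Outcome A B S))} {x : α → Letter A B}
    (hs : Computable s) (hP : Computable P) (hQ : Computable Q) (hx : Computable x) :
    Computable fun a => rootSteps g t (s a) (P a) (Q a) (x a) := by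
  have hP1 : Computable fun a => (P a).1 := Computable.fst.comp hP
  have hP2 : Computable fun a => (P a).2 := Computable.snd.comp hP
  have hQ1 : Computable fun a => (Q a).1 := Computable.fst.comp hQ
  have hQ2 : Computable fun a => (Q a).2 := Computable.snd.comp hQ
  have h : Computable fun a => Sum.casesOn
      (motive := fun _ => Prog A B × List (RatComb (Outcome A B S))) (x a)
      (fun c => rootSteps g t (s a) (P a) (Q a) (.inl c))
      fun u => Sum.casesOn (motive := fun _ => Prog A B × List (RatComb (Outcome A B S))) u
        (fun c => rootSteps g t (s a) (P a) (Q a) (.inr (.inl c)))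
        fun v => Sum.casesOn (motive := fun _ => Prog A B × List (RatComb (Outcome A B S))) v
          (fun c => rootSteps g t (s a) (P a) (Q a) (.inr (.inr (.inl c))))
          (fun c => rootSteps g t (s a) (P a) (Q a) (.inr (.inr (.inr c)))) := by
    refine Computable.sumCasesOn hx ?_ ?_
    · refine Computable.pair (Prog.primrec_atom.to_comp.comp .snd) ?_
      refine Computable.list_cons.comp ?_ (.const [])
      exact RatComb.computable_mapKey (f := fun _ => Sum.inl)
        (Computable.sumInl.comp .snd) (hg.comp (Computable.snd.pair (hs.comp .fst)))
    refine Computable.sumCasesOn .snd ?_ ?_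
    · have e1 : Computable fun y : (α × ((B × Bool) ⊕ RatProb ⊕ Fin 4)) × (B × Bool) => y.2.1 :=
        Computable.fst.comp .snd
      have e2 : Computable fun y : (α × ((B × Bool) ⊕ RatProb ⊕ Fin 4)) × (B × Bool) => y.1.1 :=
        Computable.fst.comp .fst
      have et := ht.comp (e1.pair (hs.comp e2))
      refine Computable.cond (Computable.snd.comp .snd) ?_ ?_
      · refine (Prog.primrec_ite.to_comp.comp (e1.pair
          ((hP1.comp e2).pair (hQ1.comp e2)))).pair (computable_singleton_one ?_)
        exact Computable.sumInr.comp ((Computable.cond et (hP1.comp e2) (hQ1.comp e2)).pair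
          (hs.comp e2))
      · have hl := Prog.primrec_loop.to_comp.comp e1 (hP1.comp e2)
        refine hl.pair (computable_singleton_one ?_)
        exact Computable.cond et (Computable.sumInr.comp
          ((Prog.primrec_seq.to_comp.comp (hP1.comp e2) hl).pair (hs.comp e2)))
          (Computable.sumInl.comp (hs.comp e2))
    refine Computable.sumCasesOn .snd ?_ ?_
    · have e2 : Computable fun y : ((α × ((B × Bool) ⊕ RatProb ⊕ Fin 4)) × (RatProb ⊕ Fin 4)) ×
          RatProb => y.1.1.1 := Computable.fst.comp (Computable.fst.comp .fst)
      exact (Prog.primrec_prob.to_comp.comp (Computable.snd.pair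
        ((hP1.comp e2).pair (hQ1.comp e2)))).pair
        (computable_mixLists .snd (hP2.comp e2) (hQ2.comp e2))
    · have e2 : Computable fun y : ((α × ((B × Bool) ⊕ RatProb ⊕ Fin 4)) × (RatProb ⊕ Fin 4)) ×
          Fin 4 => y.1.1.1 := Computable.fst.comp (Computable.fst.comp .fst)
      refine Computable.ite_eq .snd ?_ (Computable.ite_eq .snd ?_ (Computable.ite_eq .snd ?_ ?_))
      · exact (Computable.const _).pair
          (computable_singleton_one (Computable.sumInl.comp (hs.comp e2)))
      · exact (Prog.primrec_seq.to_comp.comp (hP1.comp e2) (hQ1.comp e2)).pair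
          (computable_map_resume Prog.primrec_seq (hQ1.comp e2) (hQ1.comp e2) (hP2.comp e2))
      · exact (Prog.primrec_par.to_comp.comp (hP1.comp e2) (hQ1.comp e2)).pair
          (Computable.list_append.comp
            (computable_map_resume Prog.primrec_par (hQ1.comp e2) (hQ1.comp e2) (hP2.comp e2))
            -- The right component moves here, hence `par` with its arguments exchanged.
            (computable_map_resume Prog.primrec_par.swap (hP1.comp e2) (hP1.comp e2)
              (hQ2.comp e2)))
      · exact (Prog.primrec_choice.to_comp.comp (hP1.comp e2) (hQ1.comp e2)).pair
          (Computable.list_append.comp (hP2.comp e2) (hQ2.comp e2))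
  refine h.of_eq fun a => ?_
  rcases x a with c | c | c | c <;> rfl

theorem computable_stepsList {g : A → S → RatComb S} {t : B → S → Bool}
    (hg : Computable fun x : A × S => g x.1 x.2) (ht : Computable fun x : B × S => t x.1 x.2) :
    Computable fun c : Conf A B S => stepsList g t c.1 c.2 := by
  have hpush : Computable₂ fun (c : Conf A B S)
      (y : Letter A B × List (Prog A B × List (RatComb (Outcome A B S)))) =>
      pushSteps g t c.2 y.1 y.2 := by
    have e : Computable fun z : Conf A B S ×
        (Letter A B × List (Prog A B × List (RatComb (Outcome A B S)))) => z.2.2 :=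
      Computable.snd.comp .snd
    refine Computable.list_cons.comp (computable_rootSteps hg ht (Computable.snd.comp .fst)
      (Computable.option_getD (Primrec.list_head?.to_comp.comp e) (.const _))
      (Computable.option_getD (Primrec.list_head?.to_comp.comp
        (Primrec.list_tail.to_comp.comp e)) (.const _)) (Computable.fst.comp .snd)) ?_
    exact Primrec.list_drop.to_comp.comp
      (Prog.primrec_arity.to_comp.comp (Computable.fst.comp .snd)) e
  have h := Computable.list_foldr (Prog.primrec_word.to_comp.comp
    (Computable.fst (α := Prog A B) (β := S))) (.const []) hpush
  have h' := Computable.option_getD (Primrec.list_head?.to_comp.comp h)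
    (.const ((.skip, []) : Prog A B × List (RatComb (Outcome A B S))))
  refine (Computable.snd.comp h').of_eq fun c => ?_
  have := foldr_pushSteps_word g t c.2 c.1 []
  exact congrArg (fun l => (l.head?.getD (Prog.skip, [])).2) this

end Primrec

end Steps

/-! ### Computing the sets `Fₙ` by repeated expansion -/

section Expand

variable {A B S : Type*}

/-- The valuations of an outcome after at most `n` further steps. -/
def outcomeSet (I : Interp A B S) (n : ℕ) : Outcome A B S → Set (Val S) :=
  Sum.elim (fun s => {Finsupp.single s 1}) (FSet I n)

/-- The Minkowski sum `∑ qᵢ · Fₙ(xᵢ)` over the entries of a list. -/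
def minkowski (I : Interp A B S) (n : ℕ) : RatComb (Outcome A B S) → Set (Val S)
  | [] => {0}
  | e :: l => {μ | ∃ v ∈ outcomeSet I n e.1, ∃ μ' ∈ minkowski I n l, μ = fracVal e.2 • v + μ'}

theorem mem_minkowski_cons {I : Interp A B S} {n : ℕ} {e : Outcome A B S × ℕ × ℕ}
    {l : RatComb (Outcome A B S)} {μ : Val S} : μ ∈ minkowski I n (e :: l) ↔
      ∃ v ∈ outcomeSet I n e.1, ∃ μ' ∈ minkowski I n l, μ = fracVal e.2 • v + μ' :=
  Iff.rfl

theorem mem_minkowski_singleton {I : Interp A B S} {n : ℕ} {e : Outcome A B S × ℕ × ℕ}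
    {μ : Val S} : μ ∈ minkowski I n [e] ↔ ∃ v ∈ outcomeSet I n e.1, μ = fracVal e.2 • v := by
  simp [minkowski]

theorem mem_minkowski_append {I : Interp A B S} {n : ℕ} {l m : RatComb (Outcome A B S)}
    {μ : Val S} : μ ∈ minkowski I n (l ++ m) ↔
      ∃ μ₁ ∈ minkowski I n l, ∃ μ₂ ∈ minkowski I n m, μ = μ₁ + μ₂ := by
  induction l generalizing μ with
  | nil => simp [minkowski]
  | cons e l ih =>
    simp only [List.cons_append, mem_minkowski_cons, ih]
    constructor
    · rintro ⟨v, hv, _, ⟨μ₁, h1, μ₂, h2, rfl⟩, rfl⟩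
      exact ⟨_, ⟨v, hv, μ₁, h1, rfl⟩, μ₂, h2, (add_assoc _ _ _).symm⟩
    · rintro ⟨_, ⟨v, hv, μ₁, h1, rfl⟩, μ₂, h2, rfl⟩
      exact ⟨v, hv, _, ⟨μ₁, h1, μ₂, h2, rfl⟩, add_assoc _ _ _⟩

theorem mem_minkowski_scale {I : Interp A B S} {n : ℕ} {q : ℕ × ℕ} {l : RatComb (Outcome A B S)}
    {μ : Val S} : μ ∈ minkowski I n (l.scale q) ↔ ∃ μ' ∈ minkowski I n l, μ = fracVal q • μ' := by
  induction l generalizing μ with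
  | nil => simp [minkowski, RatComb.scale]
  | cons e l ih =>
    rw [RatComb.scale, List.map_cons, ← RatComb.scale]
    simp only [mem_minkowski_cons, ih]
    constructor
    · rintro ⟨v, hv, _, ⟨μ', h, rfl⟩, rfl⟩
      exact ⟨_, ⟨v, hv, μ', h, rfl⟩, by rw [fracVal_mul, smul_add, mul_smul]⟩
    · rintro ⟨_, ⟨v, hv, μ', h, rfl⟩, rfl⟩
      exact ⟨v, hv, _, ⟨μ', h, rfl⟩, by rw [fracVal_mul, smul_add, mul_smul]⟩

theorem linearCombination_val {X M : Type*} [AddCommMonoid M] [Module ℝ≥0 M] (F : X → M)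
    (l : RatComb X) :
    Finsupp.linearCombination ℝ≥0 F l.val = (l.map fun e => fracVal e.2 • F e.1).sum := by
  induction l with
  | nil => simp
  | cons e l ih => simp [RatComb.val_cons, ih]

theorem RatComb.support_val_subset {X : Type*} {l : RatComb X} {x : X}
    (h : x ∈ l.val.support) : x ∈ l.map Prod.fst := by
  classical
  induction l with
  | nil => simp at h
  | cons e l ih =>
    rw [RatComb.val_cons] at h
    rcases Finset.mem_union.1 (Finsupp.support_add h) with h | h
    · rw [Finset.mem_singleton.1 (Finsupp.support_single_subset h)]
      simp
    · exact List.mem_cons_of_mem _ (ih h)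

/-- When no point is repeated, choosing a valuation for each entry is the same as choosing one for
each configuration. With repetitions the Minkowski sum could be larger: in general `½ · F + ½ · F`
is not `F`. -/
theorem mem_minkowski_iff_exists_choice {I : Interp A B S} {n : ℕ}
    {l : RatComb (Outcome A B S)} (hl : (l.map Prod.fst).Nodup) {μ : Val S} :
    μ ∈ minkowski I n l ↔ ∃ f : Conf A B S → Val S,
      (∀ c, Sum.inr c ∈ l.map Prod.fst → f c ∈ FSet I n c) ∧
        μ = Finsupp.linearCombination ℝ≥0 (Sum.elim (fun s => Finsupp.single s 1) f) l.val := by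
  classical
  simp only [linearCombination_val]
  induction l generalizing μ with
  | nil => simp [minkowski]
  | cons e l ih =>
    rw [List.map_cons, List.nodup_cons] at hl
    obtain ⟨x, q⟩ := e
    rw [mem_minkowski_cons]
    constructor
    · rintro ⟨v, hv, μ', hμ', rfl⟩
      obtain ⟨f, hf, rfl⟩ := (ih hl.2).1 hμ'
      rcases x with s | c
      · obtain rfl : v = Finsupp.single s 1 := hv
        exact ⟨f, fun c hc => hf c (by simpa using hc), by simp⟩
      · have hne : ∀ c', Sum.inr c' ∈ l.map Prod.fst → c' ≠ c := by
          rintro c' hc' rfl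
          exact hl.1 hc'
        -- The configuration `c` does not recur in the tail, so the update leaves the choices made
        -- there intact.
        refine ⟨Function.update f c v, fun c' hc' => ?_, ?_⟩
        · by_cases hcc : c' = c
          · subst hcc; rw [Function.update_self]; exact hv
          · rw [Function.update_of_ne hcc]
            refine hf c' ?_
            simpa [hcc] using hc'
        · rw [List.map_cons, List.sum_cons]
          simp only [Sum.elim_inr, Function.update_self]
          congr 2
          refine List.map_congr_left fun e he => ?_
          rcases e with ⟨s | c', r⟩
          · rfl
          · rw [Sum.elim_inr, Sum.elim_inr, Function.update_of_ne
              (hne c' (List.mem_map_of_mem (f := Prod.fst) he))]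
    · rintro ⟨f, hf, rfl⟩
      refine ⟨Sum.elim (fun s => Finsupp.single s 1) f x, ?_, _,
        (ih hl.2).2 ⟨f, fun c hc => hf c (List.mem_cons_of_mem _ hc), rfl⟩, by simp⟩
      rcases x with s | c
      · exact rfl
      · exact hf c (by simp)

/-- A list may keep configurations with coefficient `0`, which are outside the support. A choice
extends to them because `FSet` is nonempty, and its values there do not contribute. -/
theorem exists_choice_iff {I : Interp A B S} {n : ℕ} {ν : Val1 (Outcome A B S)}
    {K : Set (Outcome A B S)} (hK : ∀ x ∈ ν.weights.support, x ∈ K) {μ : Val S} :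
    (∃ f : Conf A B S → Val S, (∀ c, Sum.inr c ∈ ν.weights.support → f c ∈ FSet I n c) ∧
      μ = collapse ν f) ↔
    ∃ f : Conf A B S → Val S, (∀ c, Sum.inr c ∈ K → f c ∈ FSet I n c) ∧ μ = collapse ν f := by
  classical
  constructor
  · rintro ⟨f, hf, rfl⟩
    refine ⟨fun c => if Sum.inr c ∈ ν.weights.support then f c else (FSet_nonempty I n c).choose,
      fun c _ => ?_, ?_⟩
    · dsimp only
      split_ifs with h
      · exact hf c h
      · exact (FSet_nonempty I n c).choose_spec
    · refine Finset.sum_congr rfl fun x hx => ?_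
      rcases x with s | c
      · rfl
      · simp only [Sum.elim_inr, if_pos hx]
  · rintro ⟨f, hf, rfl⟩
    exact ⟨f, fun c hc => hf c (hK _ hc), rfl⟩

/-- Merging is essential: a step selects one element of `Fₙ` for each resulting configuration, even
if a presentation lists that configuration several times. -/
theorem mem_FSet_succ_iff [DecidableEq (Outcome A B S)] {I : Interp A B S} {g : A → S → RatComb S}
    (hg : ∀ a s, (g a s).val = (I.atom a s).weights) {n : ℕ} {c : Conf A B S} {μ : Val S} :
    μ ∈ FSet I (n + 1) c ↔
      ∃ l ∈ stepsList g I.cond c.1 c.2, μ ∈ minkowski I n (RatComb.merge l) := by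
  have key : ∀ (ν : Val1 (Outcome A B S)) (l : RatComb (Outcome A B S)), l.val = ν.weights →
      ((∃ f : Conf A B S → Val S, (∀ c, Sum.inr c ∈ ν.weights.support → f c ∈ FSet I n c) ∧
        μ = collapse ν f) ↔ μ ∈ minkowski I n (RatComb.merge l)) := by
    intro ν l e
    rw [exists_choice_iff (K := {x | x ∈ (RatComb.merge l).map Prod.fst}),
      mem_minkowski_iff_exists_choice (RatComb.nodup_merge l)]
    · simp only [collapse_eq_linearCombination, RatComb.val_merge, e]
      rfl
    · intro x hx
      rw [← e, ← RatComb.val_merge] at hx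
      exact RatComb.support_val_subset hx
  constructor
  · rintro ⟨ν, hν, hf⟩
    obtain ⟨l, hl, e⟩ := exists_mem_stepsList_of_step hg hν
    exact ⟨l, hl, (key ν l e).1 hf⟩
  · rintro ⟨l, hl, h⟩
    obtain ⟨ν, hν, e⟩ := exists_step_of_mem_stepsList hg hl
    exact ⟨ν, hν, (key ν l e).2 h⟩

/-- The part of a combination that consists of final states. -/
def terminated (l : RatComb (Outcome A B S)) : RatComb S :=
  l.flatMap fun e => Sum.elim (fun s => [(s, e.2)]) (fun _ => []) e.1

theorem mem_minkowski_zero_iff {I : Interp A B S} {l : RatComb (Outcome A B S)}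
    {μ : Val S} :
    μ ∈ minkowski I 0 l ↔ μ = (terminated l).val := by
  induction l generalizing μ with
  | nil => rfl
  | cons e l ih =>
    obtain ⟨s | c, q⟩ := e
    · simp [mem_minkowski_cons, outcomeSet, ih, terminated, RatComb.val_cons]
    · simp [mem_minkowski_cons, outcomeSet, ih, terminated, FSet]

theorem computable_terminated [Primcodable A] [Primcodable B] [Primcodable S] :
    Computable (terminated : RatComb (Outcome A B S) → RatComb S) := by
  refine Computable.id.list_flatMap (g := fun (_ : RatComb (Outcome A B S))
    (e : Outcome A B S × ℕ × ℕ) => Sum.elim (fun s => [(s, e.2)]) (fun _ => []) e.1) ?_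
  refine (Computable.sumCasesOn
    (f := fun x : RatComb (Outcome A B S) × (Outcome A B S × ℕ × ℕ) => x.2.1)
    (g := fun x s => ([(s, x.2.2)] : RatComb S)) (h := fun _ _ => [])
    (Computable.fst.comp .snd) ?_ (.const [])).of_eq fun e => by
      rcases e with ⟨_, _ | _, _⟩ <;> rfl
  exact Computable.list_cons.comp
    (Computable.snd.pair (Computable.snd.comp (Computable.snd.comp .fst))) (.const [])

variable [DecidableEq (Outcome A B S)]

/-- The combinations that replace an entry when its configuration makes a step. -/
def expandEntry (g : A → S → RatComb S) (t : B → S → Bool) (e : Outcome A B S × ℕ × ℕ) :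
    List (RatComb (Outcome A B S)) :=
  Sum.elim (fun _ => [[e]])
    (fun c => (stepsList g t c.1 c.2).map fun l => (RatComb.merge l).scale e.2) e.1

/-- The combinations reached when all configurations make a step. -/
def expand (g : A → S → RatComb S) (t : B → S → Bool) (l : RatComb (Outcome A B S)) :
    List (RatComb (Outcome A B S)) :=
  l.foldr (fun e L => (expandEntry g t e).flatMap fun u => L.map (u ++ ·)) [[]]

/-- The recursion for `Fₙ` calls itself at other configurations. Expanding whole combinations turns
it into plain iteration on `n`. -/
def expandIter (g : A → S → RatComb S) (t : B → S → Bool) (n : ℕ)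
    (l : RatComb (Outcome A B S)) : List (RatComb (Outcome A B S)) :=
  Nat.rec [l] (fun _ L => L.flatMap (expand g t)) n

/-- The elements of `Fₙ`. -/
def listFSet (g : A → S → RatComb S) (t : B → S → Bool) (n : ℕ) (c : Conf A B S) :
    List (RatComb S) :=
  (expandIter g t n [(.inr c, 1, 0)]).map terminated

section Correctness

variable {I : Interp A B S} {g : A → S → RatComb S}

theorem exists_mem_expandEntry_iff (hg : ∀ a s, (g a s).val = (I.atom a s).weights) {n : ℕ}
    {e : Outcome A B S × ℕ × ℕ} {μ : Val S} :
    (∃ l ∈ expandEntry g I.cond e, μ ∈ minkowski I n l) ↔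
      ∃ v ∈ outcomeSet I (n + 1) e.1, μ = fracVal e.2 • v := by
  obtain ⟨s | c, q⟩ := e
  · simp [expandEntry, mem_minkowski_singleton, outcomeSet]
  · simp only [expandEntry, Sum.elim_inr, List.mem_map, exists_exists_and_eq_and,
      mem_minkowski_scale, outcomeSet, mem_FSet_succ_iff hg]
    constructor
    · rintro ⟨l, hl, μ', hμ', rfl⟩
      exact ⟨μ', ⟨l, hl, hμ'⟩, rfl⟩
    · rintro ⟨μ', ⟨l, hl, hμ'⟩, rfl⟩
      exact ⟨l, hl, μ', hμ', rfl⟩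

/-- One expansion trades one level of `Fₙ` for a union. The blocks from different entries are
concatenated without merging, since a configuration reached along different branches may be
continued differently. -/
theorem exists_mem_expand_iff (hg : ∀ a s, (g a s).val = (I.atom a s).weights) {n : ℕ}
    {l : RatComb (Outcome A B S)} {μ : Val S} :
    (∃ l' ∈ expand g I.cond l, μ ∈ minkowski I n l') ↔ μ ∈ minkowski I (n + 1) l := by
  induction l generalizing μ with
  | nil => simp [expand, minkowski]
  | cons e l ih =>
    rw [expand, List.foldr_cons, ← expand, mem_minkowski_cons]
    simp only [List.mem_flatMap, List.mem_map]
    constructor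
    · rintro ⟨_, ⟨u, hu, l', hl', rfl⟩, h⟩
      obtain ⟨μ₁, h1, μ₂, h2, rfl⟩ := mem_minkowski_append.1 h
      obtain ⟨v, hv, rfl⟩ := (exists_mem_expandEntry_iff hg).1 ⟨u, hu, h1⟩
      exact ⟨v, hv, μ₂, ih.1 ⟨l', hl', h2⟩, rfl⟩
    · rintro ⟨v, hv, μ₂, h2, rfl⟩
      obtain ⟨u, hu, h1⟩ := (exists_mem_expandEntry_iff hg).2 ⟨v, hv, rfl⟩
      obtain ⟨l', hl', h2⟩ := ih.2 h2
      exact ⟨_, ⟨u, hu, l', hl', rfl⟩, mem_minkowski_append.2 ⟨_, h1, _, h2, rfl⟩⟩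

theorem exists_mem_expandIter_iff (hg : ∀ a s, (g a s).val = (I.atom a s).weights) {n k : ℕ}
    {l : RatComb (Outcome A B S)} {μ : Val S} :
    (∃ l' ∈ expandIter g I.cond n l, μ ∈ minkowski I k l') ↔ μ ∈ minkowski I (n + k) l := by
  induction n generalizing k with
  | zero => simp [expandIter]
  | succ n ih =>
    have e : expandIter g I.cond (n + 1) l =
        (expandIter g I.cond n l).flatMap (expand g I.cond) := rfl
    rw [Nat.add_right_comm n 1 k, Nat.add_assoc, ← ih, e]
    simp only [List.mem_flatMap, ← exists_mem_expand_iff hg]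
    constructor
    · rintro ⟨l'', ⟨l', hl', hl''⟩, h⟩
      exact ⟨l', hl', l'', hl'', h⟩
    · rintro ⟨l', hl', l'', hl'', h⟩
      exact ⟨l'', ⟨l', hl', hl''⟩, h⟩

theorem FSet_eq_listFSet (hg : ∀ a s, (g a s).val = (I.atom a s).weights) (n : ℕ)
    (c : Conf A B S) : FSet I n c = {μ | ∃ l ∈ listFSet g I.cond n c, l.val = μ} := by
  ext μ
  have h : μ ∈ FSet I n c ↔ μ ∈ minkowski I (n + 0) [(.inr c, 1, 0)] := by
    simp [mem_minkowski_singleton, outcomeSet]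
  rw [h, ← exists_mem_expandIter_iff hg]
  simp only [mem_minkowski_zero_iff, listFSet, Set.mem_ofPred_eq, List.mem_map,
    exists_exists_and_eq_and, @eq_comm _ μ]

end Correctness

section Computability

variable [Primcodable A] [Primcodable B] [Primcodable S] {g : A → S → RatComb S}
  {t : B → S → Bool}

theorem computable_expandEntry (hg : Computable fun x : A × S => g x.1 x.2)
    (ht : Computable fun x : B × S => t x.1 x.2) : Computable (expandEntry (B := B) g t) := by
  refine (Computable.sumCasesOn (f := fun e : Outcome A B S × ℕ × ℕ => e.1)
    (g := fun e _ => ([[e]] : List (RatComb (Outcome A B S))))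
    (h := fun e c => (stepsList g t c.1 c.2).map fun l => (RatComb.merge l).scale e.2)
    .fst ?_ ?_).of_eq fun e => by rcases e with ⟨_ | _, _⟩ <;> rfl
  · exact Computable.list_cons.comp (Computable.list_cons.comp .fst (.const [])) (.const [])
  · exact ((computable_stepsList hg ht).comp .snd).list_map
      (g := fun (x : (Outcome A B S × ℕ × ℕ) × Conf A B S) l => (RatComb.merge l).scale x.1.2)
      (RatComb.primrec_scale.to_comp.comp (Computable.snd.comp (Computable.fst.comp .fst))
        (RatComb.primrec_merge.to_comp.comp .snd))

theorem computable_expand (hg : Computable fun x : A × S => g x.1 x.2)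
    (ht : Computable fun x : B × S => t x.1 x.2) : Computable (expand (B := B) g t) := by
  refine Computable.list_foldr .id (.const [[]])
    (h := fun _ (x : (Outcome A B S × ℕ × ℕ) × List (RatComb (Outcome A B S))) =>
      (expandEntry g t x.1).flatMap fun u => x.2.map (u ++ ·)) ?_
  refine ((computable_expandEntry hg ht).comp (Computable.fst.comp .snd)).list_flatMap
    (g := fun (x : RatComb (Outcome A B S) × ((Outcome A B S × ℕ × ℕ) ×
      List (RatComb (Outcome A B S)))) u => x.2.2.map (u ++ ·)) ?_
  exact (Computable.snd.comp (Computable.snd.comp .fst)).list_map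
    (Computable.list_append.comp (Computable.snd.comp .fst) .snd)

theorem computable_listFSet (hg : Computable fun x : A × S => g x.1 x.2)
    (ht : Computable fun x : B × S => t x.1 x.2) :
    Computable fun x : ℕ × Conf A B S => listFSet g t x.1 x.2 := by
  have h : Computable fun x : ℕ × Conf A B S => expandIter g t x.1 [(.inr x.2, 1, 0)] := by
    refine Computable.nat_rec (f := fun x : ℕ × Conf A B S => x.1)
      (g := fun x => ([[(.inr x.2, 1, 0)]] : List (RatComb (Outcome A B S))))
      (h := fun _ y => y.2.flatMap (expand g t)) .fst ?_ ?_
    · exact computable_singleton_one (Computable.sumInr.comp .snd)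
    · exact (Computable.snd.comp .snd).list_flatMap (g := fun _ => expand g t)
        ((computable_expand hg ht).comp .snd)
  exact h.list_map (g := fun _ => terminated) (computable_terminated.comp .snd)

end Computability

end Expand

theorem ratFiniteComputable_FSet {A B S : Type*} [Primcodable A] [Primcodable B] [Primcodable S]
    (I : Interp A B S) (hatom : RatComputable fun x : A × S => (I.atom x.1 x.2).weights)
    (hcond : Computable fun x : B × S => I.cond x.1 x.2) :
    RatFiniteComputable fun x : ℕ × Conf A B S => FSet I x.1 x.2 := by
  classical
  obtain ⟨g, hg, hval⟩ := hatom
  exact ⟨_, computable_listFSet (g := fun a s => g (a, s)) hg hcond,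
    fun x => FSet_eq_listFSet (fun a s => hval (a, s)) x.1 x.2⟩

/-! ### Renaming of atomic programs and conditions -/

section Renaming

variable {A B A' B' S : Type*}

def Prog.map (f : A' → A) (h : B' → B) : Prog A' B' → Prog A B
  | .skip => .skip
  | .atom a => .atom (f a)
  | .seq P Q => .seq (P.map f h) (Q.map f h)
  | .par P Q => .par (P.map f h) (Q.map f h)
  | .prob p P Q => .prob p (P.map f h) (Q.map f h)
  | .choice P Q => .choice (P.map f h) (Q.map f h)
  | .ite b P Q => .ite (h b) (P.map f h) (Q.map f h)
  | .loop b P => .loop (h b) (P.map f h)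

theorem Prog.map_injective {f : A' → A} {h : B' → B} (hf : f.Injective) (hh : h.Injective) :
    (Prog.map f h).Injective := by
  intro P
  induction P with
  | skip => intro Q e; cases Q <;> simp only [Prog.map, reduceCtorEq] at e; rfl
  | atom a =>
    intro Q e
    cases Q <;> simp only [Prog.map, reduceCtorEq, Prog.atom.injEq] at e
    rw [hf e]
  | seq P Q hP hQ | par P Q hP hQ | choice P Q hP hQ =>
    intro R e
    cases R <;> simp only [Prog.map, reduceCtorEq, Prog.seq.injEq, Prog.par.injEq,
      Prog.choice.injEq] at e
    rw [hP e.1, hQ e.2]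
  | prob p P Q hP hQ =>
    intro R e
    cases R <;> simp only [Prog.map, reduceCtorEq, Prog.prob.injEq] at e
    rw [e.1, hP e.2.1, hQ e.2.2]
  | ite b P Q hP hQ =>
    intro R e
    cases R <;> simp only [Prog.map, reduceCtorEq, Prog.ite.injEq] at e
    rw [hh e.1, hP e.2.1, hQ e.2.2]
  | loop b P hP =>
    intro R e
    cases R <;> simp only [Prog.map, reduceCtorEq, Prog.loop.injEq] at e
    rw [hh e.1, hP e.2]

/-- Every program uses finitely many atomic programs and conditions only. -/
theorem Prog.exists_finite_support (P : Prog A B) : ∃ (X : Set A) (Y : Set B), X.Finite ∧ Y.Finite ∧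
    ∀ {A' B' : Type} (f : A' → A) (h : B' → B), X ⊆ Set.range f → Y ⊆ Set.range h →
      ∃ P' : Prog A' B', P'.map f h = P := by
  induction P with
  | skip => exact ⟨∅, ∅, Set.finite_empty, Set.finite_empty, fun f h _ _ => ⟨.skip, rfl⟩⟩
  | atom a =>
    refine ⟨{a}, ∅, Set.finite_singleton _, Set.finite_empty, fun f h hX _ => ?_⟩
    obtain ⟨a', rfl⟩ := hX rfl
    exact ⟨.atom a', rfl⟩
  | seq P Q hP hQ | par P Q hP hQ | choice P Q hP hQ | prob p P Q hP hQ =>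
    obtain ⟨X₁, Y₁, hX₁, hY₁, h₁⟩ := hP
    obtain ⟨X₂, Y₂, hX₂, hY₂, h₂⟩ := hQ
    refine ⟨X₁ ∪ X₂, Y₁ ∪ Y₂, hX₁.union hX₂, hY₁.union hY₂, fun f h hX hY => ?_⟩
    obtain ⟨P', rfl⟩ := h₁ f h (Set.subset_union_left.trans hX) (Set.subset_union_left.trans hY)
    obtain ⟨Q', rfl⟩ := h₂ f h (Set.subset_union_right.trans hX) (Set.subset_union_right.trans hY)
    first
      | exact ⟨.seq P' Q', rfl⟩
      | exact ⟨.par P' Q', rfl⟩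
      | exact ⟨.choice P' Q', rfl⟩
      | exact ⟨.prob p P' Q', rfl⟩
  | ite b P Q hP hQ =>
    obtain ⟨X₁, Y₁, hX₁, hY₁, h₁⟩ := hP
    obtain ⟨X₂, Y₂, hX₂, hY₂, h₂⟩ := hQ
    refine ⟨X₁ ∪ X₂, insert b (Y₁ ∪ Y₂), hX₁.union hX₂, (hY₁.union hY₂).insert b,
      fun f h hX hY => ?_⟩
    obtain ⟨b', rfl⟩ := hY (Set.mem_insert _ _)
    replace hY := (Set.subset_insert _ _).trans hY
    obtain ⟨P', rfl⟩ := h₁ f h (Set.subset_union_left.trans hX) (Set.subset_union_left.trans hY)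
    obtain ⟨Q', rfl⟩ := h₂ f h (Set.subset_union_right.trans hX) (Set.subset_union_right.trans hY)
    exact ⟨.ite b' P' Q', rfl⟩
  | loop b P hP =>
    obtain ⟨X, Y, hX, hY, h₁⟩ := hP
    refine ⟨X, insert b Y, hX, hY.insert b, fun f h hX hY => ?_⟩
    obtain ⟨b', rfl⟩ := hY (Set.mem_insert _ _)
    obtain ⟨P', rfl⟩ := h₁ f h hX ((Set.subset_insert _ _).trans hY)
    exact ⟨.loop b' P', rfl⟩

def Interp.comap (I : Interp A B S) (f : A' → A) (h : B' → B) : Interp A' B' S where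
  atom a := I.atom (f a)
  cond b := I.cond (h b)

def Conf.map (f : A' → A) (h : B' → B) (c : Conf A' B' S) : Conf A B S := (c.1.map f h, c.2)

variable {I : Interp A B S} {f : A' → A} {h : B' → B}

theorem Step.map {c : Conf A' B' S} {ν : Val1 (Outcome A' B' S)} (H : Step (I.comap f h) c ν) :
    Step I (Conf.map f h c) (ν.map (Sum.map id (Conf.map f h))) := by
  induction H with
  | atom a s =>
    have := Step.atom (I := I) (f a) s
    rw [StdSimplex.map_map]
    exact this
  | skip s =>
    rw [StdSimplex.map_single]
    exact .skip s
  | @seq P Q s ν H ih =>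
    convert! Step.seq (Q := Q.map f h) ih using 1
    rw [StdSimplex.map_map, StdSimplex.map_map]
    congr 1
    funext x
    rcases x with _ | _ <;> rfl
  | @parLeft P Q s ν H ih =>
    convert! Step.parLeft (Q := Q.map f h) ih using 1
    rw [StdSimplex.map_map, StdSimplex.map_map]
    congr 1
    funext x
    rcases x with _ | _ <;> rfl
  | @parRight P Q s ν H ih =>
    convert! Step.parRight (P := P.map f h) ih using 1
    rw [StdSimplex.map_map, StdSimplex.map_map]
    congr 1
    funext x
    rcases x with _ | _ <;> rfl
  | @prob p P Q s μ ν H1 H2 ih1 ih2 =>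
    convert! Step.prob (p := p) ih1 ih2 using 1
    ext1
    simp [Finsupp.mapDomain_add, Finsupp.mapDomain_smul]
  | choiceLeft H ih => exact .choiceLeft ih
  | choiceRight H ih => exact .choiceRight ih
  | iteTrue H => rw [StdSimplex.map_single]; exact .iteTrue H
  | iteFalse H => rw [StdSimplex.map_single]; exact .iteFalse H
  | loopTrue H => rw [StdSimplex.map_single]; exact .loopTrue H
  | loopFalse H => rw [StdSimplex.map_single]; exact .loopFalse H

/-- A renamed program has no new steps, since the rules inspect atomic programs and conditions only
through their interpretation. -/
theorem Step.exists_of_map {P : Prog A' B'} {s : S} {ν : Val1 (Outcome A B S)}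
    (H : Step I (P.map f h, s) ν) :
    ∃ ν', Step (I.comap f h) (P, s) ν' ∧ ν = ν'.map (Sum.map id (Conf.map f h)) := by
  induction P generalizing s ν with
  | skip => cases H; exact ⟨_, .skip s, by rw [StdSimplex.map_single]; rfl⟩
  | atom a => cases H; exact ⟨_, .atom a s, by rw [StdSimplex.map_map]; rfl⟩
  | seq P Q hP hQ =>
    cases H with
    | seq H =>
      obtain ⟨ν, hν, rfl⟩ := hP H
      refine ⟨_, .seq hν, ?_⟩
      rw [StdSimplex.map_map, StdSimplex.map_map]
      congr 1
      funext x
      rcases x with _ | _ <;> rfl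
  | par P Q hP hQ =>
    cases H with
    | parLeft H =>
      obtain ⟨ν, hν, rfl⟩ := hP H
      refine ⟨_, .parLeft hν, ?_⟩
      rw [StdSimplex.map_map, StdSimplex.map_map]
      congr 1
      funext x
      rcases x with _ | _ <;> rfl
    | parRight H =>
      obtain ⟨ν, hν, rfl⟩ := hQ H
      refine ⟨_, .parRight hν, ?_⟩
      rw [StdSimplex.map_map, StdSimplex.map_map]
      congr 1
      funext x
      rcases x with _ | _ <;> rfl
  | prob p P Q hP hQ =>
    cases H with
    | prob H1 H2 =>
      obtain ⟨μ, hμ, rfl⟩ := hP H1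
      obtain ⟨ν, hν, rfl⟩ := hQ H2
      refine ⟨_, .prob hμ hν, ?_⟩
      ext1
      simp [Finsupp.mapDomain_add, Finsupp.mapDomain_smul]
  | choice P Q hP hQ =>
    cases H with
    | choiceLeft H =>
      obtain ⟨ν, hν, rfl⟩ := hP H
      exact ⟨_, .choiceLeft hν, rfl⟩
    | choiceRight H =>
      obtain ⟨ν, hν, rfl⟩ := hQ H
      exact ⟨_, .choiceRight hν, rfl⟩
  | ite b P Q hP hQ =>
    cases H with
    | iteTrue H => exact ⟨_, .iteTrue H, by rw [StdSimplex.map_single]; rfl⟩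
    | iteFalse H => exact ⟨_, .iteFalse H, by rw [StdSimplex.map_single]; rfl⟩
  | loop b P hP =>
    cases H with
    | loopTrue H => exact ⟨_, .loopTrue H, by rw [StdSimplex.map_single]; rfl⟩
    | loopFalse H => exact ⟨_, .loopFalse H, by rw [StdSimplex.map_single]; rfl⟩

theorem collapse_map (ν : Val1 (Outcome A' B' S)) (F : Conf A B S → Val S) :
    collapse (ν.map (Sum.map id (Conf.map f h))) F = collapse ν fun c => F (Conf.map f h c) := by
  rw [collapse_eq_linearCombination, collapse_eq_linearCombination, StdSimplex.weights_map,
    Finsupp.linearCombination_mapDomain]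
  congr 2
  funext x
  rcases x with _ | _ <;> rfl

/-- Injectivity keeps distinct configurations distinct, so that choices made at them independently
can be transported along the renaming. -/
theorem FSet_map (hf : f.Injective) (hh : h.Injective) (n : ℕ) (c : Conf A' B' S) :
    FSet I n (Conf.map f h c) = FSet (I.comap f h) n c := by
  classical
  have hinj : (Conf.map f h : Conf A' B' S → Conf A B S).Injective := by
    rintro ⟨P, s⟩ ⟨Q, t⟩ e
    obtain ⟨e1, rfl⟩ := Prod.mk.inj e
    exact congrArg (·, s) (Prog.map_injective hf hh e1)
  have hinj' : (Sum.map id (Conf.map f h) : Outcome A' B' S → Outcome A B S).Injective :=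
    Function.injective_id.sumMap hinj
  have hsupp : ∀ (ν : Val1 (Outcome A' B' S)) (c : Conf A' B' S),
      Sum.inr (Conf.map f h c) ∈ (ν.map (Sum.map id (Conf.map f h))).weights.support ↔
        Sum.inr c ∈ ν.weights.support := by
    intro ν c
    rw [Finsupp.mem_support_iff, Finsupp.mem_support_iff, StdSimplex.weights_map]
    exact Iff.of_eq (congrArg (· ≠ 0) (Finsupp.mapDomain_apply hinj' ν.weights (Sum.inr c)))
  induction n generalizing c with
  | zero => rfl
  | succ n ih =>
    ext μ
    constructor
    · rintro ⟨ν, hν, F, hF, rfl⟩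
      obtain ⟨ν, hν', rfl⟩ := Step.exists_of_map hν
      exact ⟨ν, hν', fun c => F (Conf.map f h c),
        fun c' hc' => ih c' ▸ hF _ ((hsupp ν c').2 hc'), collapse_map ν F⟩
    -- The choice is extended by `0` outside the range of the renaming, where the renamed valuation
    -- has no support.
    · rintro ⟨ν, hν, F, hF, rfl⟩
      refine ⟨_, hν.map, Function.extend (Conf.map f h) F 0, fun c' hc' => ?_, ?_⟩
      · obtain ⟨x, hx, e⟩ := Finset.mem_image.1 (Finsupp.mapDomain_support hc')
        rcases x with s | c''
        · simp at e
        · obtain rfl : Conf.map f h c'' = c' := Sum.inr.inj e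
          rw [hinj.extend_apply, ih]
          exact hF c'' hx
      · rw [collapse_map]
        simp only [hinj.extend_apply]

end Renaming

/-- The program uses finitely many atomic programs and conditions; numbering them by `Fin k` and
`Fin l` supplies codes, and computability of each becomes uniform computability. -/
theorem ratFiniteComputable_FSet_of_prog {A B S : Type*} [Primcodable S] (I : Interp A B S)
    (hatom : ∀ a, RatComputable fun s => (I.atom a s).weights)
    (hcond : ∀ b, Computable (I.cond b)) (P : Prog A B) :
    RatFiniteComputable fun x : ℕ × S => FSet I x.1 (P, x.2) := by
  obtain ⟨X, Y, hX, hY, H⟩ := P.exists_finite_support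
  obtain ⟨k, f, hf⟩ := hX.fin_embedding
  obtain ⟨l, h, hh⟩ := hY.fin_embedding
  obtain ⟨P', rfl⟩ := H f h hf.ge hh.ge
  choose g hg hval using hatom
  obtain ⟨F, hF, hFval⟩ := ratFiniteComputable_FSet (I.comap f h)
    ⟨fun x => g (f x.1) x.2, Computable.fin_uncurry (f := fun i => g (f i)) fun i => hg _,
      fun x => hval _ _⟩
    (Computable.fin_uncurry (f := fun i => I.cond (h i)) fun i => hcond _)
  exact ⟨_, hF.comp (Computable.fst.pair ((Computable.const P').pair .snd)), fun x => by
    rw [← hFval]; exact FSet_map f.injective h.injective x.1 (P', x.2)⟩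

/-! ### Semi-decidability -/

theorem PForm.sat_finAnd {S : Type*} {k : ℕ} {φ : Fin k → PForm S} {μ : Val S} :
    (PForm.finAnd φ).Sat μ ↔ ∀ i, (φ i).Sat μ := by
  have h : ∀ l : List (PForm S), (l.foldr PForm.and PForm.top).Sat μ ↔ ∀ ψ ∈ l, ψ.Sat μ := by
    intro l
    induction l with
    | nil => simp [PForm.Sat]
    | cons ψ l ih => simp [PForm.Sat, ih]
  rw [PForm.finAnd, h]
  simp [List.mem_ofFn]

section SemiDecidability

variable {A B S α : Type*} [Primcodable S] [Primcodable α] {I : Interp A B S}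
  {conf : α → Conf A B S} {φ : PForm S}

/-- The test runs through a finite list and compares rational masses with the thresholds; unbounded
search over positive `n` does the rest. -/
theorem maySemiDecidable_of_sat_iff
    (hF : RatFiniteComputable fun x : ℕ × α => FSet I x.1 (conf x.2)) {k : ℕ} (p : Fin k → ℚ≥0)
    (U : Fin k → Set S) (hU : ∀ i, ComputablePred fun s => s ∈ U i)
    (hφ : ∀ μ, φ.Sat μ ↔ ∃ i, (p i : ℝ≥0) < μ.mass (U i)) : MaySemiDecidable I conf φ := by
  obtain ⟨F, hF, hFval⟩ := hF
  have hsearch := fun a => dia_iff_exists_FSet I (conf a) φ _ U hφ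
  have htest : ComputablePred fun x : ℕ × α => ∃ μ ∈ FSet I x.1 (conf x.2), φ.Sat μ := by
    refine (ComputablePred.exists_mem_list (ComputablePred.exists_fin fun i =>
      RatComb.computablePred_lt_mass (p i) (hU i)) hF).of_eq fun x => ?_
    simp [hFval, hφ]
  exact ⟨((((PrimrecPred.computablePred (Primrec.nat_le.comp (.const 1) .fst)).and
    htest).exists_nat_re)).of_eq fun a => (hsearch a).symm, htest, hsearch⟩

theorem mustSemiDecidable_of_sat_iff
    (hF : RatFiniteComputable fun x : ℕ × α => FSet I x.1 (conf x.2)) {k : ℕ} (p : Fin k → ℚ≥0)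
    (U : Fin k → Set S) (hU : ∀ i, ComputablePred fun s => s ∈ U i)
    (hφ : ∀ μ, φ.Sat μ ↔ ∀ i, (p i : ℝ≥0) < μ.mass (U i)) : MustSemiDecidable I conf φ := by
  obtain ⟨F, hF, hFval⟩ := hF
  have hsearch := fun a => box_iff_exists_FSet I (conf a) φ _ U hφ
  have htest : ComputablePred fun x : ℕ × α => ∀ μ ∈ FSet I x.1 (conf x.2), φ.Sat μ := by
    refine (ComputablePred.forall_mem_list (ComputablePred.forall_fin fun i =>
      RatComb.computablePred_lt_mass (p i) (hU i)) hF).of_eq fun x => ?_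
    simp [hFval, hφ]
  exact ⟨((((PrimrecPred.computablePred (Primrec.nat_le.comp (.const 1) .fst)).and
    htest).exists_nat_re)).of_eq fun a => (hsearch a).symm, htest, hsearch⟩

theorem statisticalTerminationSemiDecidable_of_ratFiniteComputable
    (hF : RatFiniteComputable fun x : ℕ × α => FSet I x.1 (conf x.2)) :
    StatisticalTerminationSemiDecidable I conf := by
  refine ⟨hF, fun p U _ hU => ⟨?_, ?_⟩, fun k p U _ hU => ⟨?_, ?_⟩⟩
  -- A single formula is the case `k = 1`.
  · exact maySemiDecidable_of_sat_iff hF (fun _ : Fin 1 => p) (fun _ => U) (fun _ => hU)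
      fun μ => by simp [PForm.Sat]
  · exact mustSemiDecidable_of_sat_iff hF (fun _ : Fin 1 => p) (fun _ => U) (fun _ => hU)
      fun μ => by simp [PForm.Sat]
  · exact maySemiDecidable_of_sat_iff hF p U hU fun μ => Iff.rfl
  · exact mustSemiDecidable_of_sat_iff hF p U hU fun μ => by
      rw [PForm.sat_finAnd]; rfl

end SemiDecidability

theorem mainTheorem6 {A B S : Type*} [Primcodable S] (I : Interp A B S) :
    ((∀ a, RatComputable fun s => (I.atom a s).weights) → (∀ b, Computable (I.cond b)) →
      ∀ P : Prog A B, StatisticalTerminationSemiDecidable I (fun s : S => (P, s))) ∧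
    (∀ [Primcodable A] [Primcodable B],
      RatComputable (fun x : A × S => (I.atom x.1 x.2).weights) →
      Computable (fun x : B × S => I.cond x.1 x.2) →
      StatisticalTerminationSemiDecidable I (fun c : Conf A B S => c)) :=
  ⟨fun hatom hcond P => statisticalTerminationSemiDecidable_of_ratFiniteComputable
      (ratFiniteComputable_FSet_of_prog I hatom hcond P),
    fun hatom hcond => statisticalTerminationSemiDecidable_of_ratFiniteComputable
      (ratFiniteComputable_FSet I hatom hcond)⟩
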